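/- **Theorem (Converging to a First-order Stationary Point).** Let $N\ge 1$, $d\ge 0$, $f_1,\dots,f_N:\mathbb{R}^d\to\mathbb{R}$, $F=\frac1N\sum_{i=1}^N f_i$, and let $A=[a_{ij}]\in\mathbb{R}^{N\times N}$ with $a_{ij}\ge 0$ for $i\ne j$. Assume: 1. $A$ is symmetric, $\mathbf 1^\top A=\mathbf 1^\top$, $A\mathbf 1=\mathbf 1$, and the spectral norm satisfies $\|A-\frac1N\mathbf 1\mathbf 1^\top\|<1$ (in particular this holds if the Frobenius norm is $<1$); 2. every $f_i$ is twice differentiable, and $\|\nabla f_i(x)-\nabla f_i(y)\|\le L_i\|x-y\|$, $\|\nabla^2 f_i(x)-\nabla^2 f_i(y)\|\le\rho_i\|x-y\|$ (operator norm) for all $x,y\in\mathbb{R}^d$; the average $\rho=\frac1N\sum_i\rho_i$ is positive; 3. $\|\nabla f_i(\theta)\|\le G$ for all $i$ and all $\theta\in\mathbb{R}^d$. *Quantization.* Let $\ell>0$. At an even iteration $k$, a coordinate $v\in[n\ell,(n+1)\ell)$, $n\in\mathbb Z$, is rounded randomly to $(n+1)\ell$ with probability $v/\ell-n$ and to $n\ell$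 otherwise. At an odd iteration, $v\in[(n-\frac12)\ell,(n+\frac12)\ell)$ is rounded to $(n+\frac12)\ell$ with probability $v/\ell-n+\frac12$ and to $(n-\frac12)\ell$ otherwise. These probabilities are conditional on the history up to the $k$-th iterate; no assumption is made on the joint conditional law of the roundings of different coordinates and agents. Write $Q_\ell(x_j^k)$ for the coordinatewise quantization of $x_j^k$. *Algorithm.* From deterministic $x_i^0\in\mathbb{R}^d$, for $k=0,1,2,\dots$ and all $i$, with $\mathcal N_i=\{j:a_{ij}>0\}$, $$x_i^{k+1}=x_i^k+\varepsilon_k\sum_{j\in\mathcal N_i\cup\{i\}}a_{ij}\bigl(Q_\ell(x_j^k)-x_i^k\bigr)-\eta_k\nabla f_i(x_i^k),\qquad \bar x^k=\frac1N\sum_{i=1}^N x_i^k .$$ *Stepsize strategy.* Given $0<p<1$ and an accuracy $\epsilon>0$, choose $0.6<\alpha<\frac23$, $\frac32\alpha<\beta<1$, $c_1,c_2>0$, and let $r_\alpha(t)=\frac{c_1}{1+c_2t^\alpha}$, $r_\beta(t)=\frac{c_1}{1+c_2t^\beta}$. Let $f^\star$ be a lower bound of $F$ on $\mathbb{R}^d$,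 $f_0=F(\bar x^0)$, $\gamma>0$ any constant, $\sigma_2$ the second largest eigenvalue of $A$ ($\sigma_2=0$ if $N=1$), and put $$d_1=\tfrac{1+(1-\sigma_2)\varepsilon_0}{1-\sigma_2}G^2,\quad d_2=(1+(1-\sigma_2)\varepsilon_0)\sigma_2^2Nd\ell^2\quad(\varepsilon_0=c_1),\quad Q=\tfrac1{60^2}\sqrt{\epsilon^3/\rho},$$ $$C_1=\Bigl(\tfrac{4c_1^{2/3}(d_1+d_2)}{p\,c_2^{2/3}(1-\sigma_2)}\Bigr)^{\frac3{2\alpha}},\quad C_2=\Bigl(\tfrac{4(f_0-f^\star)(d_1+d_2)^{2/3}(1-\sigma_2)^{2/3}c_1}{c_2\,p\,\epsilon^2\sqrt{\rho\epsilon}}\Bigr)^{\frac1{2\alpha-\beta}},\quad C_3=\Bigl(\tfrac{12\rho(d_1+d_2)^{1/6}}{(1-\sigma_2)^{1/6}\sqrt\gamma(\rho\epsilon)^{1/4}\ell}\Bigr)^{\frac1{\beta-4\alpha/3}} .$$ Choose an integer $t_0\ge\max\{C_1,C_2,C_3\}$ and let $$t_{i+1}=t_i+\Bigl\lceil\tfrac{1+c_2t_i^\alpha}{c_1\sqrt{\rho\epsilon}}\Bigr\rceil\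 (i\ge0),\qquad I=\Bigl\lceil 30\max\Bigl\{\tfrac{f_0-f^\star}{Q},\tfrac{2(f_0-f^\star)r_\alpha(t_0)}{\epsilon^2r_\beta(t_0)}\Bigr\}\Bigr\rceil .$$ Set $\varepsilon_k=r_\alpha(k)$, $\eta_k=r_\beta(k)$ for $k<t_0$ and for $k\ge t_I$, and $\varepsilon_k=r_\alpha(t_i)$, $\eta_k=r_\beta(t_i)$ for $t_i\le k<t_{i+1}$, $0\le i<I$. Then $$\mathbb P\Bigl(\lim_{k\to\infty}\|\nabla F(\bar x^k)\|^2=0\Bigr)\ge 1-p .$$ -/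

import Mathlib

open MeasureTheory ProbabilityTheory Filter Topology

noncomputable section

/-- Vectors of `ℝ^d` with the Euclidean norm. -/
abbrev Vec (d : ℕ) : Type := EuclideanSpace ℝ (Fin d)

/-- The data of a distributed optimization problem with `N` agents in dimension `d`. -/
structure DistProblem (N d : ℕ) where
  /-- weight matrix of the network -/
  A : Matrix (Fin N) (Fin N) ℝ
  /-- local objective functions -/
  f : Fin N → Vec d → ℝ
  /-- Lipschitz constants of the local gradients -/
  L : Fin N → ℝ
  /-- Lipschitz constants of the local Hessians -/
  rho : Fin N → ℝ
  /-- bound on the local gradients -/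
  G : ℝ
  /-- initial points of the agents -/
  x0 : Fin N → Vec d

/-- The average of the `N` rows of `x`. -/
def rowAvg {N d : ℕ} (x : Fin N → Vec d) : Vec d := (N : ℝ)⁻¹ • ∑ i, x i

namespace DistProblem

variable {N d : ℕ} (P : DistProblem N d)

/-- The global objective `F = (1/N) ∑ f_i`. -/
def F (θ : Vec d) : ℝ := (N : ℝ)⁻¹ * ∑ i, P.f i θ

/-- The averaged Hessian Lipschitz constant `ρ = (1/N) ∑ ρ_i`. -/
def rhoAvg : ℝ := (N : ℝ)⁻¹ * ∑ i, P.rho i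

/-- The value of the global objective at the averaged initial point. -/
def f0 : ℝ := P.F (rowAvg P.x0)

open Classical in
/-- The second largest eigenvalue (with multiplicity) of the symmetric matrix `A`;
`0` when there is only one agent. (`eigenvalues₀` lists the eigenvalues in decreasing order.) -/
def sigma2 : ℝ :=
  if h : P.A.IsHermitian ∧ 1 < N then h.1.eigenvalues₀ ⟨1, by simpa using h.2⟩ else 0

/-- Assumption on the weight matrix: off-diagonal weights are nonnegative, `A` is symmetric,
`1ᵀ A = 1ᵀ`, `A 1 = 1`, and the spectral norm of `A - 1 1ᵀ / N` is less than one. -/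
structure WeightAssumption : Prop where
  nonneg : ∀ i j, i ≠ j → 0 ≤ P.A i j
  symm : P.A.IsSymm
  col_sum : ∀ j, ∑ i, P.A i j = 1
  row_sum : ∀ i, ∑ j, P.A i j = 1
  norm_lt_one :
    ‖Matrix.toEuclideanCLM (n := Fin N) (𝕜 := ℝ) (P.A - Matrix.of fun _ _ => (N : ℝ)⁻¹)‖ < 1

/-- Smoothness assumption: every `f_i` is twice differentiable, with `L_i`-Lipschitz gradient and
`ρ_i`-Lipschitz Hessian (the Hessian is the derivative of the gradient map, with the operator
norm). -/
structure SmoothAssumption : Prop where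
  diff : ∀ i, Differentiable ℝ (P.f i)
  diff_grad : ∀ i, Differentiable ℝ (gradient (P.f i))
  lip_grad : ∀ i x y, ‖gradient (P.f i) x - gradient (P.f i) y‖ ≤ P.L i * ‖x - y‖
  lip_hess : ∀ i x y,
    ‖fderiv ℝ (gradient (P.f i)) x - fderiv ℝ (gradient (P.f i)) y‖ ≤ P.rho i * ‖x - y‖

/-- Bounded local gradients. -/
def BoundedGradAssumption : Prop := ∀ i θ, ‖gradient (P.f i) θ‖ ≤ P.G

end DistProblem

/-! ### Stepsize strategy -/

/-- The parameters that enter the stepsize strategy. -/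
structure Tuning where
  /-- exponent of `ε_k` -/
  α : ℝ
  /-- exponent of `η_k` -/
  β : ℝ
  c₁ : ℝ
  c₂ : ℝ
  /-- quantization interval -/
  ℓ : ℝ
  /-- failure probability -/
  p : ℝ
  /-- accuracy in the definition of approximate stationary points -/
  acc : ℝ
  /-- the constant `γ` in `C₃` -/
  γ : ℝ
  /-- lower bound on the global objective -/
  fstar : ℝ
  /-- start of the holding stages -/
  t₀ : ℕ

namespace Tuning

variable {N d : ℕ} (T : Tuning) (P : DistProblem N d)

/-- The reference function `c₁ / (1 + c₂ t^e)`. -/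
def ref (e t : ℝ) : ℝ := T.c₁ / (1 + T.c₂ * t ^ e)

/-- `d₁ = (1 + (1 - σ₂) ε_0) / (1 - σ₂) * G²`. -/
def d₁ : ℝ := (1 + (1 - P.sigma2) * T.ref T.α 0) / (1 - P.sigma2) * P.G ^ 2

/-- `d₂ = (1 + (1 - σ₂) ε_0) σ₂² N d ℓ²`. -/
def d₂ : ℝ := (1 + (1 - P.sigma2) * T.ref T.α 0) * P.sigma2 ^ 2 * N * d * T.ℓ ^ 2

def C₁ : ℝ :=
  (4 * T.c₁ ^ (2 / 3 : ℝ) * (T.d₁ P + T.d₂ P) /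
    (T.p * T.c₂ ^ (2 / 3 : ℝ) * (1 - P.sigma2))) ^ (3 / (2 * T.α))

def C₂ : ℝ :=
  (4 * (P.f0 - T.fstar) * (T.d₁ P + T.d₂ P) ^ (2 / 3 : ℝ) * (1 - P.sigma2) ^ (2 / 3 : ℝ) * T.c₁ /
    (T.c₂ * T.p * T.acc ^ 2 * √(P.rhoAvg * T.acc))) ^ (1 / (2 * T.α - T.β))

def C₃ : ℝ :=
  (12 * P.rhoAvg * (T.d₁ P + T.d₂ P) ^ (1 / 6 : ℝ) /
    ((1 - P.sigma2) ^ (1 / 6 : ℝ) * √T.γ * (P.rhoAvg * T.acc) ^ (1 / 4 : ℝ) * T.ℓ)) ^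
      (1 / (T.β - 4 * T.α / 3))

/-- `Q = (1/60²) √(ϵ³/ρ)`. -/
def Q : ℝ := 1 / 60 ^ 2 * √(T.acc ^ 3 / P.rhoAvg)

/-- The number of holding stages, rounded up to an integer. -/
def I : ℕ :=
  ⌈30 * max ((P.f0 - T.fstar) / T.Q P)
    (2 * (P.f0 - T.fstar) * T.ref T.α T.t₀ / (T.acc ^ 2 * T.ref T.β T.t₀))⌉₊

/-- The switching times: `t_0 = t₀`, `t_{i+1} = t_i + ⌈(1 + c₂ t_i^α) / (c₁ √(ρϵ))⌉`. -/
def t : ℕ → ℕ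
  | 0 => T.t₀
  | i + 1 => t i + ⌈(1 + T.c₂ * (t i : ℝ) ^ T.α) / (T.c₁ * √(P.rhoAvg * T.acc))⌉₊

/-- The stepsize with exponent `e`: it follows the reference function for `k < t_0` and for
`k ≥ t_I`, and it is held at the value of the reference function at `t_i` while
`t_i ≤ k < t_{i+1}`, `i < I`. -/
def stepsize (e : ℝ) (k : ℕ) : ℝ :=
  if k < T.t P 0 then T.ref e k
  else if k < T.t P (T.I P) then
    T.ref e (T.t P (Nat.findGreatest (fun i => T.t P i ≤ k) (T.I P)))
  else T.ref e k

/-- The choices that the stepsize strategy prescribes. -/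
structure Admissible : Prop where
  α_gt : 0.6 < T.α
  α_lt : T.α < 2 / 3
  β_gt : 3 / 2 * T.α < T.β
  β_lt : T.β < 1
  c₁_pos : 0 < T.c₁
  c₂_pos : 0 < T.c₂
  ℓ_pos : 0 < T.ℓ
  p_pos : 0 < T.p
  p_lt : T.p < 1
  acc_pos : 0 < T.acc
  γ_pos : 0 < T.γ
  fstar_le : ∀ θ, T.fstar ≤ P.F θ
  t₀_ge : max (T.C₁ P) (max (T.C₂ P) (T.C₃ P)) ≤ T.t₀

end Tuning

/-! ### Quantization and the algorithm -/

/-- The quantization level just below (or at) `v` at iteration `k`: a multiple of `ℓ` for even `k`,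
an odd multiple of `ℓ / 2` for odd `k`. The next level is `quantLow k ℓ v + ℓ`. -/
def quantLow (k : ℕ) (ℓ v : ℝ) : ℝ :=
  if Even k then (⌊v / ℓ⌋ : ℝ) * ℓ else ((⌊v / ℓ + 1 / 2⌋ : ℝ) - 1 / 2) * ℓ

/-- The probability of rounding `v` up at iteration `k`. -/
def quantProb (k : ℕ) (ℓ v : ℝ) : ℝ :=
  if Even k then v / ℓ - ⌊v / ℓ⌋ else v / ℓ - ⌊v / ℓ + 1 / 2⌋ + 1 / 2

/-- `(x, q)` is a run of the algorithm on the probability space `(Ω, μ)`: `x k ω i` is the iterate of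
agent `i` and `q k ω i` its quantization at iteration `k`. Given the history `ℱ k` before the `k`-th
quantization, each coordinate of `x k ω i` is rounded down or up to the neighbouring levels, with
the prescribed conditional probability of rounding up. Nothing is required of the joint
conditional law of the different coordinates and agents. -/
structure IsRun {N d : ℕ} (P : DistProblem N d) (T : Tuning) {Ω : Type*} {mΩ : MeasurableSpace Ω}
    (μ : Measure Ω) (ℱ : Filtration ℕ mΩ) (x q : ℕ → Ω → Fin N → Vec d) : Prop where
  init : ∀ ω i, x 0 ω i = P.x0 i
  adapted : ∀ k i s, Measurable[ℱ (k + 1)] fun ω => q k ω i s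
  quant_mem : ∀ k i s, ∀ᵐ ω ∂μ, q k ω i s = quantLow k T.ℓ (x k ω i s) ∨
    q k ω i s = quantLow k T.ℓ (x k ω i s) + T.ℓ
  quant_prob : ∀ k i s,
    μ⟦{ω | q k ω i s = quantLow k T.ℓ (x k ω i s) + T.ℓ} | ℱ k⟧
      =ᵐ[μ] fun ω => quantProb k T.ℓ (x k ω i s)
  step : ∀ k ω i, x (k + 1) ω i =
    (x k ω i + T.stepsize P T.α k •
      ∑ j with 0 < P.A i j ∨ j = i, P.A i j • (q k ω j - x k ω i))
      - T.stepsize P T.β k • gradient (P.f i) (x k ω i)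

end

/-!
The gradient `∇F(x̄^k)` at the averaged iterate tends to zero almost surely, which is more than
the claimed probability `1 - p`. Only the asymptotic form of the stepsizes matters: after the
finitely many holding stages they equal the reference functions, so `ε_k` and `η_k`
are of the orders `k^(-α)` and `k^(-β)` (`Tuning.stepConditions`).

Quantization is unbiased given the history (`IsRun.centeredNoise_coord`), so the cross terms
between the noise and the past vanish in expectation. The deviations of the agents from their
average are contracted by `1 - ε_k (1 - ‖A - 1 1ᵀ / N‖)`, up to errors of order
`η_k² / ε_k + ε_k²` (`IsRun.integral_norm_dev_succ_le`). Multiplying by the decreasing weight `η_k / ε_k` and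
telescoping shows that `∑ η_k E‖deviation‖²` converges, because `η_k³ / ε_k²` and `η_k ε_k` are
summable (`IsRun.summable_eta_mul_dev`).

Mixing preserves the average, so `x̄^(k+1) = x̄^k + ε_k · noise - η_k · g_k`, where `g_k` is the
average of the local gradients and differs from `∇F(x̄^k)` by at most the consensus error. The
descent lemma and the lower bound on `F` then give `∑ η_k E‖∇F(x̄^k)‖² < ∞`
(`IsRun.summable_eta_mul_grad`), hence `∑ η_k ‖∇F(x̄^k)‖² < ∞` almost surely.

As `∑ η_k` diverges, this only shows that the gradient is small infinitely often. But the
accumulated noise `∑ ε_k · noise` is an `L²`-bounded martingale and converges almost surely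
(`IsRun.ae_cauchySeq_noise`), and the gradients are bounded, so between two times the average
moves by at most a small amount plus a multiple of the elapsed `∑ η_k`. Since `∇F` is Lipschitz,
the gradient cannot make infinitely many excursions away from zero
(`tendsto_zero_of_summable_mul_sq`).
-/

noncomputable section

open scoped RealInnerProductSpace

/-! ### Real sequences -/

/-- Telescoping: a sequence bounded below that loses `a n` and gains a summable `b n` at each step
loses only a summable amount in total. -/
theorem summable_of_le_sub_add {u a b : ℕ → ℝ} {m : ℝ} (K : ℕ) (hu : ∀ n, m ≤ u n)
    (ha : ∀ n, 0 ≤ a n) (hb0 : ∀ n, 0 ≤ b n) (hb : Summable b)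
    (h : ∀ n, K ≤ n → u (n + 1) ≤ u n - a n + b n) : Summable a := by
  have key : ∀ n, ∑ i ∈ Finset.range n, a (i + K) ≤
      u K - u (n + K) + ∑ i ∈ Finset.range n, b (i + K) := by
    intro n
    induction n with
    | zero => simp
    | succ n ih =>
      rw [Finset.sum_range_succ, Finset.sum_range_succ]
      have := h (n + K) (by omega)
      rw [show n + 1 + K = n + K + 1 by ring]
      linarith
  refine (summable_nat_add_iff K).1 (summable_of_sum_range_le
    (c := u K - m + ∑' i, b (i + K)) (fun n => ha _) fun n => ?_)
  have h1 := ((summable_nat_add_iff K).2 hb).sum_le_tsum (Finset.range n) fun i _ => hb0 _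
  linarith [key n, hu (n + K)]

/-- Multiplying a perturbed contraction by an eventually antitone weight `w` turns it into a
telescoping inequality for `w n * v n`; no explicit decay rate of `v` is needed. -/
theorem summable_weighted_of_contraction {w e v r : ℕ → ℝ} (K : ℕ)
    (hw : ∀ n, K ≤ n → w (n + 1) ≤ w n) (hw0 : ∀ n, 0 ≤ w n) (he : ∀ n, 0 ≤ e n)
    (hv : ∀ n, 0 ≤ v n) (hr0 : ∀ n, 0 ≤ r n) (hr : Summable fun n => w n * r n)
    (h : ∀ n, K ≤ n → v (n + 1) ≤ (1 - e n) * v n + r n) :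
    Summable fun n => w n * e n * v n := by
  refine summable_of_le_sub_add (u := fun n => w n * v n) K
    (fun n => mul_nonneg (hw0 n) (hv n))
    (fun n => mul_nonneg (mul_nonneg (hw0 n) (he n)) (hv n))
    (fun n => mul_nonneg (hw0 n) (hr0 n)) hr fun n hn => ?_
  calc w (n + 1) * v (n + 1) ≤ w n * v (n + 1) := mul_le_mul_of_nonneg_right (hw n hn) (hv _)
    _ ≤ w n * ((1 - e n) * v n + r n) := mul_le_mul_of_nonneg_left (h n hn) (hw0 n)
    _ = _ := by ring

/-- If `∑ η φ²` converges while `∑ η` diverges, then `φ` is small infinitely often. The oscillation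
bound `h` upgrades this to `φ → 0`: an excursion of `φ` above a level `δ` has `η`-length at most
`δ⁻² ∑ η φ²` over a tail, so `φ` cannot grow much during it. -/
theorem tendsto_zero_of_summable_mul_sq {φ η : ℕ → ℝ} {E : Type*} [SeminormedAddCommGroup E]
    {M : ℕ → E} {L C : ℝ} (hL : 0 ≤ L) (hC : 0 ≤ C)
    (hφ : ∀ n, 0 ≤ φ n) (hη : ∀ n, 0 ≤ η n) (hη0 : Tendsto η atTop (𝓝 0)) (hηs : ¬ Summable η)
    (hs : Summable fun n => η n * φ n ^ 2) (hM : CauchySeq M)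
    (h : ∀ m n, m ≤ n → φ n ≤ φ m + L * ‖M n - M m‖ + C * ∑ k ∈ Finset.Ico m n, η k) :
    Tendsto φ atTop (𝓝 0) := by
  rw [Metric.tendsto_atTop]
  intro δ' hδ'
  -- `φ n` will be at most `4 δ`: `δ` at the start of the excursion, `δ` from `M`, `δ` from the
  -- first step (where `φ` is still below `δ`) and `δ` from the remaining steps
  obtain ⟨δ, hδ, rfl⟩ : ∃ δ : ℝ, 0 < δ ∧ δ' = 5 * δ := ⟨δ' / 5, by positivity, by ring⟩
  obtain ⟨K₁, hK₁⟩ := Metric.cauchySeq_iff.1 hM (δ / (L + 1)) (by positivity)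
  obtain ⟨K₂, hK₂⟩ := Metric.tendsto_atTop.1 hη0 (δ / (C + 1)) (by positivity)
  obtain ⟨K₃, hK₃⟩ := Metric.cauchySeq_iff.1 hs.hasSum.tendsto_sum_nat.cauchySeq
    (δ ^ 3 / (C + 1)) (by positivity)
  set K := max K₁ (max K₂ K₃)
  -- otherwise `η ≤ δ⁻² η φ²` eventually, and `∑ η` would converge
  obtain ⟨K', hKK', hK'⟩ : ∃ k, K ≤ k ∧ φ k < δ := by
    by_contra! hcon
    refine hηs ((summable_nat_add_iff K).1 (Summable.of_nonneg_of_le (fun n => hη _) (fun n => ?_)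
      (((summable_nat_add_iff K).2 hs).mul_left (δ ^ 2)⁻¹)))
    have h1 := hcon (n + K) (by omega)
    rw [le_inv_mul_iff₀ (by positivity), mul_comm]
    exact mul_le_mul_of_nonneg_left (pow_le_pow_left₀ hδ.le h1 2) (hη _)
  -- the last index `m ≤ n` at which `φ` is below `δ`
  have last : ∀ n, K' ≤ n → ∃ m, K' ≤ m ∧ m ≤ n ∧ φ m < δ ∧ ∀ k, m < k → k ≤ n → δ ≤ φ k := by
    intro n hn
    induction n, hn using Nat.le_induction with
    | base => exact ⟨K', le_rfl, le_rfl, hK', fun k h1 h2 => by omega⟩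
    | succ n hn ih =>
      by_cases hc : φ (n + 1) < δ
      · exact ⟨n + 1, by omega, le_rfl, hc, fun k h1 h2 => by omega⟩
      · obtain ⟨m, h1, h2, h3, h4⟩ := ih
        refine ⟨m, h1, by omega, h3, fun k h5 h6 => ?_⟩
        rcases Nat.lt_or_ge n k with h7 | h7
        · rw [show k = n + 1 by omega]; exact not_lt.1 hc
        · exact h4 k h5 h7
  refine ⟨K', fun n hn => ?_⟩
  rw [Real.dist_eq, sub_zero, abs_of_nonneg (hφ n)]
  obtain ⟨m, h1, h2, h3, h4⟩ := last n hn
  rcases h2.eq_or_lt with rfl | h2'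
  · linarith
  have hMb : L * ‖M n - M m‖ ≤ δ := by
    have := (hK₁ n (by omega) m (by omega)).le
    rw [dist_eq_norm, le_div_iff₀ (by positivity)] at this
    nlinarith [norm_nonneg (M n - M m)]
  have hηm : C * η m ≤ δ := by
    have := (hK₂ m (by omega)).le
    rw [Real.dist_eq, sub_zero, abs_of_nonneg (hη m), le_div_iff₀ (by positivity)] at this
    nlinarith [hη m]
  have hsum : C * ∑ k ∈ Finset.Ico (m + 1) n, η k ≤ δ := by
    have h5 : δ ^ 2 * ∑ k ∈ Finset.Ico (m + 1) n, η k ≤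
        ∑ k ∈ Finset.Ico (m + 1) n, η k * φ k ^ 2 := by
      rw [Finset.mul_sum]
      refine Finset.sum_le_sum fun k hk => ?_
      rw [Finset.mem_Ico] at hk
      rw [mul_comm]
      exact mul_le_mul_of_nonneg_left
        (pow_le_pow_left₀ hδ.le (h4 k (by omega) (by omega)) 2) (hη _)
    have h6 := (hK₃ n (by omega) (m + 1) (by omega)).le
    rw [Real.dist_eq, ← Finset.sum_Ico_eq_sub _ (by omega : m + 1 ≤ n),
      le_div_iff₀ (by positivity)] at h6
    have h7 := le_abs_self (∑ k ∈ Finset.Ico (m + 1) n, η k * φ k ^ 2)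
    have h8 : 0 ≤ ∑ k ∈ Finset.Ico (m + 1) n, η k := Finset.sum_nonneg fun k _ => hη k
    have h9 : δ ^ 2 * ((C + 1) * ∑ k ∈ Finset.Ico (m + 1) n, η k) ≤ δ ^ 2 * δ := by
      calc _ = (δ ^ 2 * ∑ k ∈ Finset.Ico (m + 1) n, η k) * (C + 1) := by ring
        _ ≤ |∑ k ∈ Finset.Ico (m + 1) n, η k * φ k ^ 2| * (C + 1) := by gcongr; linarith
        _ ≤ _ := by linarith [h6]
    have := le_of_mul_le_mul_left h9 (by positivity)
    linarith
  have h10 := h m n h2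
  rw [Finset.sum_eq_sum_Ico_succ_bot h2', mul_add] at h10
  linarith

theorem summable_of_le_rpow {u : ℕ → ℝ} {e C : ℝ} (K : ℕ) (he : 1 < e) (h0 : ∀ k, 0 ≤ u k)
    (h : ∀ k : ℕ, K ≤ k → 1 ≤ (k : ℝ) → u k ≤ C * (k : ℝ) ^ (-e)) : Summable u := by
  have hs : Summable fun k : ℕ => C * (k : ℝ) ^ (-e) :=
    (Real.summable_nat_rpow.2 (show -e < -1 by linarith)).mul_left C
  have hs' := (summable_nat_add_iff (K + 1)).2 hs
  refine (summable_nat_add_iff (K + 1)).1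
    (Summable.of_nonneg_of_le (fun k => h0 (k + (K + 1))) (fun k => ?_) hs')
  refine h (k + (K + 1)) (by omega) ?_
  exact_mod_cast (by omega : 1 ≤ k + (K + 1))

/-! ### Stepsizes -/

/-- The properties of a mixing stepsize `ε` and a gradient stepsize `η` that give convergence.
`eps_sq` and `eta_sq` control the noise and second-order terms, `eps_eta` and `eta_cube` the
consensus error caused by the quantization noise and by the gradients, and `ratio` provides the
antitone weight `η / ε` for the consensus recursion. -/
structure StepConditions (ε η : ℕ → ℝ) : Prop where
  eps_pos : ∀ k, 0 < ε k
  eta_pos : ∀ k, 0 < η k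
  eps_sq : Summable fun k => ε k ^ 2
  eta_sq : Summable fun k => η k ^ 2
  eps_eta : Summable fun k => η k * ε k
  eta_cube : Summable fun k => η k ^ 3 / ε k ^ 2
  eta_div : ¬ Summable η
  ratio : ∀ᶠ k in atTop, η (k + 1) / ε (k + 1) ≤ η k / ε k

namespace Tuning

variable {N d : ℕ} {T : Tuning} {P : DistProblem N d}

/-- The holding stages end, so only the reference function matters asymptotically. -/
theorem stepsize_eq_ref (T : Tuning) (P : DistProblem N d) (e : ℝ) :
    ∀ k, max (T.t P 0) (T.t P (T.I P)) ≤ k → T.stepsize P e k = T.ref e k := by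
  intro k hk
  have h1 : ¬ k < T.t P 0 := by have := le_max_left (T.t P 0) (T.t P (T.I P)); omega
  have h2 : ¬ k < T.t P (T.I P) := by have := le_max_right (T.t P 0) (T.t P (T.I P)); omega
  simp [stepsize, h1, h2]

theorem ref_pos (hT : T.Admissible P) (e : ℝ) {t : ℝ} (ht : 0 ≤ t) : 0 < T.ref e t := by
  have := hT.c₁_pos
  have := hT.c₂_pos
  have := Real.rpow_nonneg ht e
  unfold ref
  positivity

theorem stepsize_pos (hT : T.Admissible P) (e : ℝ) (k : ℕ) : 0 < T.stepsize P e k := by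
  unfold stepsize
  split_ifs <;> exact ref_pos hT e (Nat.cast_nonneg _)

theorem ref_le (hT : T.Admissible P) (e : ℝ) {t : ℝ} (ht : 1 ≤ t) :
    T.ref e t ≤ T.c₁ / T.c₂ * t ^ (-e) := by
  have h1 := hT.c₁_pos
  have h2 := hT.c₂_pos
  have h3 := Real.rpow_pos_of_pos (by linarith : 0 < t) e
  rw [ref, Real.rpow_neg (by linarith), ← div_eq_mul_inv, div_div]
  gcongr
  linarith

theorem le_ref (hT : T.Admissible P) {e : ℝ} (he : 0 ≤ e) {t : ℝ} (ht : 1 ≤ t) :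
    T.c₁ / (1 + T.c₂) * t ^ (-e) ≤ T.ref e t := by
  have h1 := hT.c₁_pos
  have h2 := hT.c₂_pos
  have h3 := Real.one_le_rpow ht he
  rw [ref, Real.rpow_neg (by linarith), ← div_eq_mul_inv, div_div]
  gcongr
  nlinarith

/-- As `α < β`, the ratio `(1 + c₂ t ^ α) / (1 + c₂ t ^ β)` decreases for `t ≥ 1`. -/
theorem ref_ratio_antitone (hT : T.Admissible P) {s t : ℝ} (hs : 1 ≤ s) (hst : s ≤ t) :
    T.ref T.β t / T.ref T.α t ≤ T.ref T.β s / T.ref T.α s := by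
  have h1 := hT.c₁_pos
  have h2 := hT.c₂_pos
  have hα : 0 ≤ T.α := by have := hT.α_gt; norm_num at this; linarith
  have hαβ : 0 ≤ T.β - T.α := by have := hT.β_gt; linarith
  have e : ∀ r : ℝ, 1 ≤ r → r ^ T.β = r ^ T.α * r ^ (T.β - T.α) := fun r hr => by
    rw [← Real.rpow_add (by linarith)]; congr 1; ring
  have p : ∀ r : ℝ, 1 ≤ r → T.ref T.β r / T.ref T.α r =
      (1 + T.c₂ * r ^ T.α) / (1 + T.c₂ * r ^ T.β) := fun r hr => by
    have h3 := Real.rpow_pos_of_pos (by linarith : 0 < r) T.α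
    have h4 := Real.rpow_pos_of_pos (by linarith : 0 < r) T.β
    unfold ref
    field_simp
  rw [p t (hs.trans hst), p s hs, e t (hs.trans hst), e s hs]
  have a1 := Real.one_le_rpow hs hα
  have b1 := Real.one_le_rpow hs hαβ
  have a2 : s ^ T.α ≤ t ^ T.α := Real.rpow_le_rpow (by linarith) hst hα
  have b2 : s ^ (T.β - T.α) ≤ t ^ (T.β - T.α) := Real.rpow_le_rpow (by linarith) hst hαβ
  generalize s ^ T.α = a at *
  generalize t ^ T.α = A at *
  generalize s ^ (T.β - T.α) = b at *
  generalize t ^ (T.β - T.α) = B at *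
  have hB : 1 ≤ B := b1.trans b2
  have hA : 1 ≤ A := a1.trans a2
  rw [div_le_div_iff₀ (by positivity) (by positivity)]
  have e1 : a * (b - 1) ≤ A * (B - 1) :=
    mul_le_mul a2 (by linarith) (by linarith) (by linarith)
  have e2 : a * A * b ≤ a * A * B := mul_le_mul_of_nonneg_left b2 (by positivity)
  nlinarith [mul_le_mul_of_nonneg_left e1 h2.le,
    mul_le_mul_of_nonneg_left e2 (by positivity : 0 ≤ T.c₂ ^ 2)]

/-- With `3/5 < α` and `3/2 α < β < 1`, the exponents `2 α`, `2 β`, `α + β` and `3 β - 2 α` all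
exceed `1`. -/
theorem stepConditions (hT : T.Admissible P) :
    StepConditions (T.stepsize P T.α) (T.stepsize P T.β) := by
  have h1 := hT.c₁_pos
  have h2 := hT.c₂_pos
  have hα : (0.6 : ℝ) < T.α := hT.α_gt
  have hβ := hT.β_gt
  have hβ1 := hT.β_lt
  norm_num at hα
  have hpos := stepsize_pos hT
  set K := max (T.t P 0) (T.t P (T.I P)) with hK
  have hle : ∀ e : ℝ, ∀ k : ℕ, K ≤ k → 1 ≤ (k : ℝ) →
      T.stepsize P e k ≤ T.c₁ / T.c₂ * (k : ℝ) ^ (-e) := fun e k hk hk1 => by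
    rw [stepsize_eq_ref T P e k hk]; exact ref_le hT e hk1
  have hge : ∀ e : ℝ, 0 ≤ e → ∀ k : ℕ, K ≤ k → 1 ≤ (k : ℝ) →
      T.c₁ / (1 + T.c₂) * (k : ℝ) ^ (-e) ≤ T.stepsize P e k := fun e he k hk hk1 => by
    rw [stepsize_eq_ref T P e k hk]; exact le_ref hT he hk1
  have hmul : ∀ a b : ℝ, 1 < a + b → Summable fun k => T.stepsize P a k * T.stepsize P b k := by
    intro a b hab
    refine summable_of_le_rpow (C := (T.c₁ / T.c₂) ^ 2) K hab
      (fun k => (mul_pos (hpos a k) (hpos b k)).le) fun k hk hk1 => ?_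
    calc _ ≤ (T.c₁ / T.c₂ * (k : ℝ) ^ (-a)) * (T.c₁ / T.c₂ * (k : ℝ) ^ (-b)) :=
          mul_le_mul (hle a k hk hk1) (hle b k hk hk1) (hpos b k).le (by positivity)
      _ = (T.c₁ / T.c₂) ^ 2 * ((k : ℝ) ^ (-a) * (k : ℝ) ^ (-b)) := by ring
      _ = _ := by rw [← Real.rpow_add (by linarith)]; congr 2; ring
  refine ⟨hpos _, hpos _, ?_, ?_, hmul _ _ (by linarith), ?_, ?_, ?_⟩
  · simpa only [sq] using hmul T.α T.α (by linarith)
  · simpa only [sq] using hmul T.β T.β (by linarith)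
  · refine summable_of_le_rpow (C := (T.c₁ / T.c₂) ^ 3 / (T.c₁ / (1 + T.c₂)) ^ 2)
      (e := 3 * T.β - 2 * T.α) K (by linarith)
      (fun k => (div_pos (pow_pos (hpos _ k) 3) (pow_pos (hpos _ k) 2)).le) fun k hk hk1 => ?_
    have hk0 : (0 : ℝ) < k := by linarith
    calc _ ≤ (T.c₁ / T.c₂ * (k : ℝ) ^ (-T.β)) ^ 3 / (T.c₁ / (1 + T.c₂) * (k : ℝ) ^ (-T.α)) ^ 2 :=
          div_le_div₀ (by positivity) (pow_le_pow_left₀ (hpos _ k).le (hle _ k hk hk1) 3)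
            (by positivity)
            (pow_le_pow_left₀ (by positivity) (hge _ (by linarith) k hk hk1) 2)
      _ = (T.c₁ / T.c₂) ^ 3 / (T.c₁ / (1 + T.c₂)) ^ 2 *
          (((k : ℝ) ^ (-T.β)) ^ 3 / ((k : ℝ) ^ (-T.α)) ^ 2) := by
            rw [mul_pow, mul_pow, mul_div_mul_comm]
      _ = _ := by
        rw [← Real.rpow_natCast ((k : ℝ) ^ (-T.β)) 3,
          ← Real.rpow_natCast ((k : ℝ) ^ (-T.α)) 2, ← Real.rpow_mul hk0.le,
          ← Real.rpow_mul hk0.le, ← Real.rpow_sub hk0]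
        congr 2
        push_cast
        ring
  · intro hs
    have h3 : Summable fun k : ℕ => (k : ℝ) ^ (-T.β) := by
      refine (summable_nat_add_iff (K + 1)).1 (Summable.of_nonneg_of_le
        (fun k => by positivity) (fun k => ?_)
        (((summable_nat_add_iff (K + 1)).2 hs).mul_left (T.c₁ / (1 + T.c₂))⁻¹))
      rw [le_inv_mul_iff₀ (by positivity)]
      refine hge T.β (by linarith) _ (by omega) ?_
      push_cast
      linarith [(Nat.cast_nonneg k : (0 : ℝ) ≤ k), (Nat.cast_nonneg K : (0 : ℝ) ≤ K)]
    have := Real.summable_nat_rpow.1 h3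
    linarith
  · filter_upwards [eventually_ge_atTop (K + 1)] with k hk
    rw [stepsize_eq_ref T P _ k (by omega), stepsize_eq_ref T P _ k (by omega),
      stepsize_eq_ref T P _ (k + 1) (by omega),
      stepsize_eq_ref T P _ (k + 1) (by omega)]
    refine ref_ratio_antitone hT ?_ ?_
    · exact_mod_cast (by omega : 1 ≤ k)
    · push_cast; linarith

end Tuning

/-! ### Bounded random variables and centred noise -/

section Noise

variable {Ω : Type*} {m mΩ : MeasurableSpace Ω} {μ : Measure Ω}
  {E E' : Type*} [NormedAddCommGroup E] [NormedAddCommGroup E']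

theorem MeasureTheory.MemLp.exists_ae_norm_le {f : Ω → E} (hf : MemLp f ⊤ μ) :
    ∃ R, ∀ᵐ ω ∂μ, ‖f ω‖ ≤ R := by
  refine ⟨(eLpNorm f ⊤ μ).toReal, ?_⟩
  filter_upwards [ae_le_eLpNormEssSup (f := f) (μ := μ)] with ω hω
  rw [← eLpNorm_exponent_top] at hω
  simpa using ENNReal.toReal_mono hf.eLpNorm_ne_top hω

theorem MeasureTheory.MemLp.continuous_comp_top [ProperSpace E] {f : Ω → E}
    (hf : MemLp f ⊤ μ) {h : E → E'} (hh : Continuous h) : MemLp (fun ω => h (f ω)) ⊤ μ := by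
  obtain ⟨R, hR⟩ := hf.exists_ae_norm_le
  obtain ⟨C, hC⟩ := (isCompact_closedBall (0 : E) R).exists_bound_of_continuousOn hh.continuousOn
  refine memLp_top_of_bound (hh.comp_aestronglyMeasurable hf.1) C ?_
  filter_upwards [hR] with ω hω
  exact hC _ (by simpa using hω)

theorem MeasureTheory.MemLp.inner_top [InnerProductSpace ℝ E] {f g : Ω → E} (hf : MemLp f ⊤ μ)
    (hg : MemLp g ⊤ μ) : MemLp (fun ω => ⟪f ω, g ω⟫) ⊤ μ := by
  obtain ⟨R, hR⟩ := hf.exists_ae_norm_le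
  obtain ⟨S, hS⟩ := hg.exists_ae_norm_le
  refine memLp_top_of_bound (hf.1.inner hg.1) (R * S) ?_
  filter_upwards [hR, hS] with ω h1 h2
  exact (norm_inner_le_norm _ _).trans
    (mul_le_mul h1 h2 (norm_nonneg _) ((norm_nonneg _).trans h1))

theorem MeasureTheory.MemLp.norm_sq_top {f : Ω → E} (hf : MemLp f ⊤ μ) :
    MemLp (fun ω => ‖f ω‖ ^ 2) ⊤ μ :=
  hf.norm.continuous_comp_top (continuous_pow 2)

theorem MeasureTheory.MemLp.integrable_top [IsFiniteMeasure μ] {f : Ω → E} (hf : MemLp f ⊤ μ) :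
    Integrable f μ := hf.integrable le_top

variable [NormedSpace ℝ E] [NormedSpace ℝ E'] [CompleteSpace E] [CompleteSpace E']

/-- An essentially bounded random vector with zero conditional expectation given `m`. -/
structure CenteredNoise (m : MeasurableSpace Ω) {mΩ : MeasurableSpace Ω} (μ : Measure Ω)
    (Z : Ω → E) : Prop where
  memLp : MemLp Z ⊤ μ
  condExp_eq : μ[Z | m] =ᵐ[μ] 0

variable [IsFiniteMeasure μ]

theorem CenteredNoise.map {Z : Ω → E}
    (h : CenteredNoise m μ Z) (T : E →L[ℝ] E') : CenteredNoise m μ fun ω => T (Z ω) := by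
  refine ⟨T.comp_memLp' h.memLp, ?_⟩
  filter_upwards [T.comp_condExp_comm h.memLp.integrable_top (m := m), h.condExp_eq] with ω h1 h2
  have h1' : T (μ[Z | m] ω) = μ[T ∘ Z | m] ω := h1
  change μ[T ∘ Z | m] ω = 0
  rw [← h1', h2]
  simp

theorem CenteredNoise.sum {ι : Type*} [Fintype ι] {Z : ι → Ω → E}
    (h : ∀ i, CenteredNoise m μ (Z i)) : CenteredNoise m μ fun ω => ∑ i, Z i ω := by
  refine ⟨memLp_finsetSum _ fun i _ => (h i).memLp, ?_⟩
  have h1 := condExp_finsetSum (s := Finset.univ) (fun i _ => (h i).memLp.integrable_top) m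
  have h2 : ∀ᵐ ω ∂μ, ∀ i, μ[Z i | m] ω = 0 := ae_all_iff.2 fun i => (h i).condExp_eq
  have e : (fun ω => ∑ i, Z i ω) = ∑ i, Z i := by ext ω; simp
  rw [e]
  filter_upwards [h1, h2] with ω h3 h4
  rw [h3]
  simp [h4]

/-- Being centred is a coordinatewise property; nothing is needed about the joint law. -/
theorem CenteredNoise.of_coord {ι : Type*} [Fintype ι] {Z : Ω → EuclideanSpace ℝ ι}
    (h : ∀ i, CenteredNoise m μ fun ω => Z ω i) : CenteredNoise m μ Z := by
  classical
  have h1 := CenteredNoise.sum fun i => (h i).map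
    ((ContinuousLinearMap.id ℝ ℝ).smulRight (EuclideanSpace.single i (1 : ℝ)))
  convert h1 using 2 with ω
  ext j
  simp [Finset.sum_apply, Pi.single_apply]

end Noise

section Inner

variable {Ω : Type*} {m mΩ : MeasurableSpace Ω} {μ : Measure Ω} [IsFiniteMeasure μ]
  {E : Type*} [NormedAddCommGroup E] [InnerProductSpace ℝ E] [CompleteSpace E]

theorem CenteredNoise.integral_inner_eq_zero (hm : m ≤ mΩ) {U Z : Ω → E}
    (hZ : CenteredNoise m μ Z) (hU : StronglyMeasurable[m] U) (hUb : MemLp U ⊤ μ) :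
    ∫ ω, ⟪U ω, Z ω⟫ ∂μ = 0 := by
  have h1 := condExp_bilin_of_stronglyMeasurable_left (innerSL ℝ) hU
    (hUb.inner_top hZ.memLp).integrable_top hZ.memLp.integrable_top
  rw [← integral_condExp hm]
  refine integral_eq_zero_of_ae ?_
  filter_upwards [h1, hZ.condExp_eq] with ω h2 h3
  have h2' : μ[fun ω => ⟪U ω, Z ω⟫ | m] ω = ⟪U ω, μ[Z | m] ω⟫ := h2
  rw [h2', h3]
  simp

theorem CenteredNoise.integral_norm_add_sq (hm : m ≤ mΩ) {U Z : Ω → E}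
    (hZ : CenteredNoise m μ Z) (hU : StronglyMeasurable[m] U) (hUb : MemLp U ⊤ μ) :
    ∫ ω, ‖U ω + Z ω‖ ^ 2 ∂μ = ∫ ω, ‖U ω‖ ^ 2 ∂μ + ∫ ω, ‖Z ω‖ ^ 2 ∂μ := by
  have h0 := hZ.integral_inner_eq_zero hm hU hUb
  simp_rw [norm_add_sq_real]
  rw [integral_add, integral_add, integral_const_mul, h0]
  · simp
  · exact hUb.norm_sq_top.integrable_top
  · exact (hUb.inner_top hZ.memLp).integrable_top.const_mul 2
  · exact hUb.norm_sq_top.integrable_top.add ((hUb.inner_top hZ.memLp).integrable_top.const_mul 2)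
  · exact hZ.memLp.norm_sq_top.integrable_top

end Inner

/-- Square-summable multiples of uniformly bounded centred noise form an `L²`-bounded martingale,
which converges almost surely. -/
theorem ae_exists_tendsto_sum_noise {Ω : Type*} {mΩ : MeasurableSpace Ω} {μ : Measure Ω}
    [IsProbabilityMeasure μ] {ℱ : Filtration ℕ mΩ} {Z : ℕ → Ω → ℝ} {ε : ℕ → ℝ} {R : ℝ}
    (hZm : ∀ k, StronglyMeasurable[ℱ (k + 1)] (Z k)) (hZ : ∀ k, CenteredNoise (ℱ k) μ (Z k))
    (hR : ∀ k, ∀ᵐ ω ∂μ, |Z k ω| ≤ R) (hε : Summable fun k => ε k ^ 2) :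
    ∀ᵐ ω ∂μ, ∃ c, Tendsto (fun n => ∑ k ∈ Finset.range n, ε k * Z k ω) atTop (𝓝 c) := by
  set M : ℕ → Ω → ℝ := fun n ω => ∑ k ∈ Finset.range n, ε k * Z k ω with hM
  have hMs : ∀ n, M (n + 1) = fun ω => M n ω + ε n * Z n ω := fun n => by
    ext ω; simp [hM, Finset.sum_range_succ]
  have hZ' : ∀ k, CenteredNoise (ℱ k) μ fun ω => ε k * Z k ω := fun k =>
    (hZ k).map (ε k • ContinuousLinearMap.id ℝ ℝ)
  have hMm : ∀ n, StronglyMeasurable[ℱ n] (M n) := fun n =>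
    Finset.stronglyMeasurable_fun_sum _ fun k hk => ((hZm k).mono (ℱ.mono
      (by rw [Finset.mem_range] at hk; omega))).const_mul _
  have hMb : ∀ n, MemLp (M n) ⊤ μ := fun n => memLp_finsetSum _ fun k _ => (hZ' k).memLp
  have hmart : Martingale M ℱ μ := by
    refine martingale_of_condExp_sub_eq_zero_nat hMm (fun n => (hMb n).integrable_top) fun n => ?_
    have : M (n + 1) - M n = fun ω => ε n * Z n ω := by
      rw [hMs]; ext ω; simp
    rw [this]
    exact (hZ' n).condExp_eq
  have hsq : ∀ n, ∫ ω, ‖M n ω‖ ^ 2 ∂μ ≤ ∑ k ∈ Finset.range n, ε k ^ 2 * R ^ 2 := by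
    intro n
    induction n with
    | zero => simp [hM]
    | succ n ih =>
      rw [hMs, (hZ' n).integral_norm_add_sq (ℱ.le n) (hMm n) (hMb n), Finset.sum_range_succ]
      refine add_le_add ih ?_
      have h1 : ∫ ω, ‖ε n * Z n ω‖ ^ 2 ∂μ ≤ ∫ ω, ε n ^ 2 * R ^ 2 ∂μ := by
        refine integral_mono_ae (hZ' n).memLp.norm_sq_top.integrable_top (integrable_const _) ?_
        filter_upwards [hR n] with ω hω
        simp only [Real.norm_eq_abs, sq_abs, mul_pow]
        exact mul_le_mul_of_nonneg_left (sq_le_sq' (abs_le.1 hω).1 (abs_le.1 hω).2) (sq_nonneg _)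
      simpa using h1
  have hbd : ∀ n, eLpNorm (M n) 1 μ ≤ ((1 + (∑' k, ε k ^ 2) * R ^ 2).toNNReal : ENNReal) := by
    intro n
    rw [eLpNorm_one_eq_lintegral_enorm, ← ofReal_integral_norm_eq_lintegral_enorm
      (hMb n).integrable_top]
    refine ENNReal.ofReal_le_ofReal ?_
    calc ∫ ω, ‖M n ω‖ ∂μ ≤ ∫ ω, (1 + ‖M n ω‖ ^ 2) ∂μ :=
          integral_mono (hMb n).integrable_top.norm
            ((integrable_const _).add (hMb n).norm_sq_top.integrable_top)
            fun ω => by nlinarith [sq_nonneg (‖M n ω‖ - 1 / 2)]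
      _ = 1 + ∫ ω, ‖M n ω‖ ^ 2 ∂μ := by
          rw [integral_add (integrable_const _) (hMb n).norm_sq_top.integrable_top]; simp
      _ ≤ _ := by
          have h2 := hε.sum_le_tsum (Finset.range n) fun i _ => sq_nonneg _
          have h3 := hsq n
          rw [← Finset.sum_mul] at h3
          nlinarith [mul_le_mul_of_nonneg_right h2 (sq_nonneg R)]
  exact hmart.submartingale.exists_ae_tendsto_of_bdd hbd

theorem ae_summable_of_summable_integral {Ω : Type*} {mΩ : MeasurableSpace Ω} {μ : Measure Ω}
    {f : ℕ → Ω → ℝ} (hf : ∀ n, Integrable (f n) μ) (h0 : ∀ n ω, 0 ≤ f n ω)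
    (hs : Summable fun n => ∫ ω, f n ω ∂μ) : ∀ᵐ ω ∂μ, Summable fun n => f n ω := by
  have h1 : ∫⁻ ω, ∑' n, ENNReal.ofReal (f n ω) ∂μ ≠ ⊤ := by
    rw [lintegral_tsum fun n => (hf n).1.aemeasurable.ennreal_ofReal]
    simp_rw [← ofReal_integral_eq_lintegral_ofReal (hf _) (ae_of_all _ (h0 _))]
    exact hs.tsum_ofReal_ne_top
  filter_upwards [ae_lt_top' (AEMeasurable.tsum
    fun n => (hf n).1.aemeasurable.ennreal_ofReal) h1] with ω hω
  have h2 := ENNReal.summable_toReal hω.ne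
  simpa [ENNReal.toReal_ofReal (h0 _ ω)] using h2

/-! ### The quantizer -/

theorem quantLow_le {ℓ : ℝ} (hℓ : 0 < ℓ) (k : ℕ) (v : ℝ) : quantLow k ℓ v ≤ v := by
  unfold quantLow
  split_ifs
  · rw [← le_div_iff₀ hℓ]; exact Int.floor_le _
  · rw [← le_div_iff₀ hℓ]; linarith [Int.floor_le (v / ℓ + 1 / 2)]

theorem le_quantLow_add {ℓ : ℝ} (hℓ : 0 < ℓ) (k : ℕ) (v : ℝ) : v ≤ quantLow k ℓ v + ℓ := by
  unfold quantLow
  split_ifs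
  · have := (div_lt_iff₀ hℓ).1 (Int.lt_floor_add_one (v / ℓ))
    linarith
  · have h := (Int.lt_floor_add_one (v / ℓ + 1 / 2))
    have := (div_lt_iff₀ hℓ).1 (show v / ℓ < (⌊v / ℓ + 1 / 2⌋ : ℝ) + 1 / 2 by linarith)
    linarith

/-- The random rounding is unbiased. -/
theorem quantLow_add_mul_quantProb {ℓ : ℝ} (hℓ : 0 < ℓ) (k : ℕ) (v : ℝ) :
    quantLow k ℓ v + ℓ * quantProb k ℓ v = v := by
  unfold quantLow quantProb
  split_ifs <;> field_simp <;> ring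

theorem measurable_quantLow (k : ℕ) (ℓ : ℝ) : Measurable (quantLow k ℓ) := by
  unfold quantLow
  split_ifs
  · exact ((measurable_from_top (f := fun n : ℤ => (n : ℝ))).comp
      (measurable_id.div_const ℓ).floor).mul_const ℓ
  · exact (((measurable_from_top (f := fun n : ℤ => (n : ℝ))).comp
      ((measurable_id.div_const ℓ).add_const _).floor).sub_const _).mul_const ℓ

theorem stronglyMeasurable_euclidean {Ω ι : Type*} {m : MeasurableSpace Ω} [Fintype ι]
    {f : Ω → EuclideanSpace ℝ ι} (h : ∀ i, Measurable[m] fun ω => f ω i) :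
    StronglyMeasurable[m] f :=
  ((MeasurableEquiv.toLp 2 (ι → ℝ)).measurable.comp (measurable_pi_lambda _ h)).stronglyMeasurable

/-! ### Averages over the agents -/

section RowAvg

variable {N d : ℕ}

theorem rowAvg_add (x y : Fin N → Vec d) :
    rowAvg (fun i => x i + y i) = rowAvg x + rowAvg y := by
  simp [rowAvg, Finset.sum_add_distrib]

theorem rowAvg_sub (x y : Fin N → Vec d) :
    rowAvg (fun i => x i - y i) = rowAvg x - rowAvg y := by
  simp [rowAvg, smul_sub]

theorem rowAvg_smul (c : ℝ) (x : Fin N → Vec d) :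
    rowAvg (fun i => c • x i) = c • rowAvg x := by
  simp [rowAvg, ← Finset.smul_sum, smul_comm c]

theorem norm_rowAvg_le (hN : 0 < N) {x : Fin N → Vec d} {R : ℝ} (h : ∀ i, ‖x i‖ ≤ R) :
    ‖rowAvg x‖ ≤ R := by
  have : (0 : ℝ) < N := by positivity
  rw [rowAvg, norm_smul, norm_inv, Real.norm_natCast, inv_mul_le_iff₀ this]
  exact (norm_sum_le_of_le _ fun i _ => h i).trans (by simp)

theorem norm_rowAvg_sq_le (x : Fin N → Vec d) :
    ‖rowAvg x‖ ^ 2 ≤ ∑ i, ‖x i‖ ^ 2 := by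
  rcases Nat.eq_zero_or_pos N with rfl | hN
  · simp [rowAvg]
  have hN1 : (1 : ℝ) ≤ N := by exact_mod_cast hN
  have h1 : ‖rowAvg x‖ ≤ (N : ℝ)⁻¹ * ∑ i, ‖x i‖ := by
    rw [rowAvg, norm_smul, norm_inv, Real.norm_natCast]
    gcongr
    exact norm_sum_le _ _
  have h2 : (∑ i, ‖x i‖) ^ 2 ≤ N * ∑ i, ‖x i‖ ^ 2 := by
    simpa using sq_sum_le_card_mul_sum_sq (s := Finset.univ) (f := fun i => ‖x i‖)
  have h3 : 0 ≤ ∑ i, ‖x i‖ ^ 2 := Finset.sum_nonneg fun i _ => sq_nonneg _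
  calc ‖rowAvg x‖ ^ 2 ≤ ((N : ℝ)⁻¹ * ∑ i, ‖x i‖) ^ 2 := pow_le_pow_left₀ (norm_nonneg _) h1 2
    _ = (N : ℝ)⁻¹ ^ 2 * (∑ i, ‖x i‖) ^ 2 := by ring
    _ ≤ (N : ℝ)⁻¹ ^ 2 * (N * ∑ i, ‖x i‖ ^ 2) := by gcongr
    _ = (N : ℝ)⁻¹ * ∑ i, ‖x i‖ ^ 2 := by field_simp
    _ ≤ 1 * ∑ i, ‖x i‖ ^ 2 := by gcongr; exact inv_le_one_of_one_le₀ hN1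
    _ = _ := one_mul _

end RowAvg

/-! ### The global objective -/

namespace DistProblem

variable {N d : ℕ} {P : DistProblem N d}

/-- A common Lipschitz constant of all local gradients. The sum of absolute values is nonnegative
even when `d = 0`, where the `L i` are unconstrained. -/
def gradLip (P : DistProblem N d) : ℝ := ∑ i, |P.L i|

theorem gradLip_nonneg (P : DistProblem N d) : 0 ≤ P.gradLip :=
  Finset.sum_nonneg fun _ _ => abs_nonneg _

theorem SmoothAssumption.norm_sub_le (h : P.SmoothAssumption) (i : Fin N) (x y : Vec d) :
    ‖gradient (P.f i) x - gradient (P.f i) y‖ ≤ P.gradLip * ‖x - y‖ := by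
  refine (h.lip_grad i x y).trans (mul_le_mul_of_nonneg_right ?_ (norm_nonneg _))
  exact (le_abs_self _).trans
    (Finset.single_le_sum (f := fun i => |P.L i|) (fun _ _ => abs_nonneg _) (Finset.mem_univ i))

theorem SmoothAssumption.continuous_gradient (h : P.SmoothAssumption) (i : Fin N) :
    Continuous (gradient (P.f i)) := (h.diff_grad i).continuous

theorem SmoothAssumption.hasGradientAt_F (h : P.SmoothAssumption) (θ : Vec d) :
    HasGradientAt P.F (rowAvg fun i => gradient (P.f i) θ) θ := by
  have h1 : HasFDerivAt P.F ((N : ℝ)⁻¹ • ∑ i, fderiv ℝ (P.f i) θ) θ :=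
    (HasFDerivAt.fun_sum fun i _ => (h.diff i θ).hasFDerivAt).const_mul _
  rw [hasGradientAt_iff_hasFDerivAt]
  have e : InnerProductSpace.toDual ℝ (Vec d) (rowAvg fun i => gradient (P.f i) θ) =
      (N : ℝ)⁻¹ • ∑ i, fderiv ℝ (P.f i) θ := by
    simp [rowAvg, toDual_gradient]
  rw [e]
  exact h1

theorem SmoothAssumption.gradient_F (h : P.SmoothAssumption) (θ : Vec d) :
    gradient P.F θ = rowAvg fun i => gradient (P.f i) θ := (h.hasGradientAt_F θ).gradient

theorem SmoothAssumption.norm_gradient_F_sub_le (h : P.SmoothAssumption) (hN : 0 < N)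
    (x y : Vec d) : ‖gradient P.F x - gradient P.F y‖ ≤ P.gradLip * ‖x - y‖ := by
  rw [h.gradient_F, h.gradient_F, ← rowAvg_sub]
  exact norm_rowAvg_le hN fun i => h.norm_sub_le i x y

theorem SmoothAssumption.continuous_gradient_F (h : P.SmoothAssumption) :
    Continuous (gradient P.F) := by
  have : gradient P.F = fun θ => rowAvg fun i => gradient (P.f i) θ := funext h.gradient_F
  rw [this]
  unfold rowAvg
  exact (continuous_finsetSum _ fun i _ => h.continuous_gradient i).const_smul (N : ℝ)⁻¹

theorem SmoothAssumption.continuous_F (h : P.SmoothAssumption) : Continuous P.F :=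
  continuous_iff_continuousAt.2 fun θ => (h.hasGradientAt_F θ).differentiableAt.continuousAt

/-- The descent lemma, with the constant `L` instead of the sharp `L / 2`. -/
theorem SmoothAssumption.descent (h : P.SmoothAssumption) (hN : 0 < N) (x y : Vec d) :
    P.F (x + y) ≤ P.F x + ⟪gradient P.F x, y⟫ + P.gradLip * ‖y‖ ^ 2 := by
  have hd : ∀ z, HasGradientAt P.F (gradient P.F z) z := fun z => by
    rw [h.gradient_F]; exact h.hasGradientAt_F z
  have h1 := (convex_closedBall x ‖y‖).norm_image_sub_le_of_norm_fderiv_le'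
    (f := P.F) (𝕜 := ℝ) (φ := fderiv ℝ P.F x) (C := P.gradLip * ‖y‖) (x := x) (y := x + y)
    (fun z _ => (hd z).differentiableAt) (fun z hz => ?_) (by simp) (by simp)
  · rw [add_sub_cancel_left, ← inner_gradient_left, Real.norm_eq_abs] at h1
    linarith [le_abs_self (P.F (x + y) - P.F x - ⟪gradient P.F x, y⟫)]
  · rw [← toDual_gradient, ← toDual_gradient, ← map_sub, LinearIsometryEquiv.norm_map]
    refine (h.norm_gradient_F_sub_le hN z x).trans
      (mul_le_mul_of_nonneg_left ?_ P.gradLip_nonneg)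
    simpa [dist_eq_norm] using hz

end DistProblem

/-! ### Average and deviation along a run -/

namespace DistProblem

variable {N d : ℕ} {P : DistProblem N d}

/-- The operator `A - 1 1ᵀ / N` on `ℝ^N`, whose norm is less than one by assumption. -/
def gossip (P : DistProblem N d) : EuclideanSpace ℝ (Fin N) →L[ℝ] EuclideanSpace ℝ (Fin N) :=
  Matrix.toEuclideanCLM (n := Fin N) (𝕜 := ℝ) (P.A - Matrix.of fun _ _ => (N : ℝ)⁻¹)

theorem gossip_apply (P : DistProblem N d) (v : EuclideanSpace ℝ (Fin N)) (i : Fin N) :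
    P.gossip v i = ∑ j, P.A i j * v j - (N : ℝ)⁻¹ * ∑ j, v j := by
  simp [gossip, Matrix.mulVec, dotProduct, Finset.mul_sum]

theorem WeightAssumption.sum_filter (h : P.WeightAssumption) (i : Fin N) (v : Fin N → Vec d)
    (x : Vec d) :
    ∑ j with 0 < P.A i j ∨ j = i, P.A i j • (v j - x) = ∑ j, P.A i j • v j - x := by
  have h1 : ∑ j with 0 < P.A i j ∨ j = i, P.A i j • (v j - x) = ∑ j, P.A i j • (v j - x) := by
    refine Finset.sum_subset (Finset.subset_univ _) fun j _ hj => ?_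
    simp only [Finset.mem_filter, Finset.mem_univ, true_and, not_or, not_lt] at hj
    rw [le_antisymm hj.1 (h.nonneg i j (Ne.symm hj.2)), zero_smul]
  rw [h1]
  simp_rw [smul_sub]
  rw [Finset.sum_sub_distrib, ← Finset.sum_smul, h.row_sum, one_smul]

theorem WeightAssumption.rowAvg_mix (h : P.WeightAssumption) (v : Fin N → Vec d) :
    rowAvg (fun i => ∑ j, P.A i j • v j) = rowAvg v := by
  unfold rowAvg
  rw [Finset.sum_comm]
  simp_rw [← Finset.sum_smul, h.col_sum, one_smul]

end DistProblem

/-- The deviations of the agents from their average in the coordinate `s`, as a vector of `ℝ^N`. -/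
def dev {N d : ℕ} (s : Fin d) (x : Fin N → Vec d) : EuclideanSpace ℝ (Fin N) :=
  WithLp.toLp 2 fun i => x i s - rowAvg x s

/-- The values of the agents in the coordinate `s`, as a vector of `ℝ^N`. -/
def coordVec {N d : ℕ} (s : Fin d) (x : Fin N → Vec d) : EuclideanSpace ℝ (Fin N) :=
  WithLp.toLp 2 fun i => x i s

theorem sum_norm_dev_sq {N d : ℕ} (x : Fin N → Vec d) :
    ∑ i, ‖x i - rowAvg x‖ ^ 2 = ∑ s, ‖dev s x‖ ^ 2 := by
  simp_rw [EuclideanSpace.real_norm_sq_eq]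
  rw [Finset.sum_comm]
  simp [dev]

theorem rowAvg_apply {N d : ℕ} (x : Fin N → Vec d) (s : Fin d) :
    rowAvg x s = (N : ℝ)⁻¹ * ∑ i, x i s := by
  simp [rowAvg]

namespace IsRun

variable {N d : ℕ} {P : DistProblem N d} {T : Tuning} {Ω : Type*} {mΩ : MeasurableSpace Ω}
    {μ : Measure Ω} {ℱ : Filtration ℕ mΩ} {x q : ℕ → Ω → Fin N → Vec d}

theorem step_eq (hrun : IsRun P T μ ℱ x q) (h₁ : P.WeightAssumption) (k : ℕ) (ω : Ω) (i : Fin N) :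
    x (k + 1) ω i = (x k ω i + T.stepsize P T.α k • (∑ j, P.A i j • q k ω j - x k ω i))
      - T.stepsize P T.β k • gradient (P.f i) (x k ω i) := by
  rw [hrun.step, h₁.sum_filter]

/-- Because `A` has unit column sums, mixing does not move the average: only noise and gradients
do. -/
theorem rowAvg_succ (hrun : IsRun P T μ ℱ x q) (h₁ : P.WeightAssumption) (k : ℕ) (ω : Ω) :
    rowAvg (x (k + 1) ω) = rowAvg (x k ω)
      + (T.stepsize P T.α k • rowAvg (fun i => q k ω i - x k ω i)
        - T.stepsize P T.β k • rowAvg fun i => gradient (P.f i) (x k ω i)) := by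
  have e : x (k + 1) ω = fun i => (x k ω i + T.stepsize P T.α k •
      (∑ j, P.A i j • q k ω j - x k ω i)) - T.stepsize P T.β k • gradient (P.f i) (x k ω i) :=
    funext fun i => hrun.step_eq h₁ k ω i
  rw [e, rowAvg_sub, rowAvg_add, rowAvg_smul, rowAvg_sub, h₁.rowAvg_mix, rowAvg_smul, rowAvg_sub]
  abel

/-- On deviations, `A` acts as `A - 1 1ᵀ / N`, and the quantization error enters additively. -/
theorem dev_succ (hN : 0 < N) (hrun : IsRun P T μ ℱ x q) (h₁ : P.WeightAssumption) (s : Fin d)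
    (k : ℕ) (ω : Ω) :
    dev s (x (k + 1) ω) = (dev s (x k ω)
        + T.stepsize P T.α k • (P.gossip (dev s (x k ω)) - dev s (x k ω))
        - T.stepsize P T.β k • dev s (fun i => gradient (P.f i) (x k ω i)))
      + T.stepsize P T.α k • P.gossip (coordVec s fun i => q k ω i - x k ω i) := by
  have hN0 : (N : ℝ) ≠ 0 := by positivity
  ext i
  simp only [dev, coordVec, PiLp.add_apply, PiLp.sub_apply, PiLp.smul_apply, smul_eq_mul,
    DistProblem.gossip_apply]
  rw [hrun.rowAvg_succ h₁, hrun.step_eq h₁]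
  simp only [PiLp.add_apply, PiLp.sub_apply, PiLp.smul_apply, smul_eq_mul, mul_sub,
    Finset.sum_sub_distrib, rowAvg_apply, WithLp.ofLp_sum, Finset.sum_apply, WithLp.ofLp_smul,
    Pi.smul_apply, ← Finset.sum_mul, h₁.row_sum, Finset.sum_const, Finset.card_univ,
    Fintype.card_fin, nsmul_eq_mul]
  field_simp
  ring

theorem stronglyMeasurable_q (hrun : IsRun P T μ ℱ x q) (k : ℕ) (i : Fin N) :
    StronglyMeasurable[ℱ (k + 1)] fun ω => q k ω i :=
  stronglyMeasurable_euclidean (hrun.adapted k i)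

theorem stronglyMeasurable_x (hrun : IsRun P T μ ℱ x q) (h₁ : P.WeightAssumption)
    (h₂ : P.SmoothAssumption) (k : ℕ) :
    ∀ i, StronglyMeasurable[ℱ k] fun ω => x k ω i := by
  induction k with
  | zero =>
    intro i
    simp_rw [hrun.init]
    exact stronglyMeasurable_const
  | succ k ih =>
    intro i
    have hx : StronglyMeasurable[ℱ (k + 1)] fun ω => x k ω i :=
      (ih i).mono (ℱ.mono (Nat.le_succ k))
    simp_rw [hrun.step_eq h₁]
    have hmix : StronglyMeasurable[ℱ (k + 1)] fun ω => ∑ j, P.A i j • q k ω j :=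
      Finset.stronglyMeasurable_fun_sum _ fun j _ =>
        (hrun.stronglyMeasurable_q k j).const_smul (P.A i j)
    have hg : StronglyMeasurable[ℱ (k + 1)] fun ω => gradient (P.f i) (x k ω i) :=
      (h₂.continuous_gradient i).comp_stronglyMeasurable hx
    exact (hx.add ((hmix.sub hx).const_smul (T.stepsize P T.α k))).sub
      (hg.const_smul (T.stepsize P T.β k))

theorem measurable_coord (hrun : IsRun P T μ ℱ x q) (h₁ : P.WeightAssumption)
    (h₂ : P.SmoothAssumption) (k : ℕ) (i : Fin N) (s : Fin d) :
    Measurable[ℱ k] fun ω => x k ω i s :=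
  ((EuclideanSpace.proj (𝕜 := ℝ) s).continuous.comp_stronglyMeasurable
    (hrun.stronglyMeasurable_x h₁ h₂ k i)).measurable

theorem abs_noise_le (hrun : IsRun P T μ ℱ x q) (hT : T.Admissible P) (k : ℕ) :
    ∀ᵐ ω ∂μ, ∀ i s, |(q k ω i - x k ω i) s| ≤ T.ℓ := by
  refine ae_all_iff.2 fun i => ae_all_iff.2 fun s => ?_
  filter_upwards [hrun.quant_mem k i s] with ω hω
  have h1 := quantLow_le hT.ℓ_pos k (x k ω i s)
  have h2 := le_quantLow_add hT.ℓ_pos k (x k ω i s)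
  rw [PiLp.sub_apply, abs_le]
  rcases hω with h | h <;> rw [h] <;> constructor <;> linarith [hT.ℓ_pos]

variable [IsProbabilityMeasure μ]

/-- The quantization error of a coordinate is centred given the history. -/
theorem centeredNoise_coord (hrun : IsRun P T μ ℱ x q) (h₁ : P.WeightAssumption)
    (h₂ : P.SmoothAssumption) (hT : T.Admissible P) (k : ℕ) (i : Fin N) (s : Fin d) :
    CenteredNoise (ℱ k) μ fun ω => (q k ω i - x k ω i) s := by
  have hℓ := hT.ℓ_pos
  have hxm := hrun.measurable_coord h₁ h₂ k i s
  have hlow : Measurable[ℱ k] fun ω => quantLow k T.ℓ (x k ω i s) :=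
    (measurable_quantLow k T.ℓ).comp hxm
  have hqm : Measurable fun ω => q k ω i s := (hrun.adapted k i s).mono (ℱ.le _) le_rfl
  have hxm' := hxm.mono (ℱ.le k) le_rfl
  have hlow' := hlow.mono (ℱ.le k) le_rfl
  set S : Set Ω := {ω | q k ω i s = quantLow k T.ℓ (x k ω i s) + T.ℓ} with hS
  have hSm : MeasurableSet S := measurableSet_eq_fun hqm (hlow'.add_const _)
  -- the error is the known quantity `D` plus `ℓ` times the indicator of rounding up
  set D : Ω → ℝ := fun ω => quantLow k T.ℓ (x k ω i s) - x k ω i s with hD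
  have hDm : StronglyMeasurable[ℱ k] D := (hlow.sub hxm).stronglyMeasurable
  have hDi : Integrable D μ := by
    refine Integrable.of_bound (hDm.mono (ℱ.le k)).aestronglyMeasurable T.ℓ
      (ae_of_all _ fun ω => ?_)
    rw [Real.norm_eq_abs, abs_le]
    have h1 := quantLow_le hℓ k (x k ω i s)
    have h2 := le_quantLow_add hℓ k (x k ω i s)
    constructor <;> simp only [hD] <;> linarith
  have hIi : Integrable (S.indicator fun _ => (1 : ℝ)) μ := (integrable_const _).indicator hSm
  have hae : (fun ω => (q k ω i - x k ω i) s) =ᵐ[μ] D + T.ℓ • S.indicator fun _ => (1 : ℝ) := by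
    filter_upwards [hrun.quant_mem k i s] with ω hω
    by_cases hm : ω ∈ S
    · have : q k ω i s = quantLow k T.ℓ (x k ω i s) + T.ℓ := hm
      simp [hm, hD, this]
      ring
    · have : q k ω i s = quantLow k T.ℓ (x k ω i s) := hω.resolve_right hm
      simp [hm, hD, this]
  refine ⟨memLp_top_of_bound (hqm.sub hxm').aestronglyMeasurable T.ℓ ?_, ?_⟩
  · filter_upwards [hrun.abs_noise_le hT k] with ω hω using hω i s
  refine (condExp_congr_ae hae).trans ((condExp_add hDi (hIi.smul T.ℓ) _).trans ?_)
  have h1 := condExp_of_stronglyMeasurable (ℱ.le k) hDm hDi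
  have h2 := condExp_smul (μ := μ) T.ℓ (S.indicator fun _ => (1 : ℝ)) (ℱ k)
  filter_upwards [h2, hrun.quant_prob k i s] with ω h3 h4
  have h5 := quantLow_add_mul_quantProb hℓ k (x k ω i s)
  rw [Pi.add_apply, h1, h3, Pi.smul_apply, smul_eq_mul]
  have h6 : μ[S.indicator fun _ => (1 : ℝ) | ℱ k] ω = quantProb k T.ℓ (x k ω i s) := h4
  rw [h6]
  simp only [hD, Pi.zero_apply]
  linarith

theorem centeredNoise_rowAvg (hrun : IsRun P T μ ℱ x q) (h₁ : P.WeightAssumption)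
    (h₂ : P.SmoothAssumption) (hT : T.Admissible P) (k : ℕ) :
    CenteredNoise (ℱ k) μ fun ω => rowAvg fun i => q k ω i - x k ω i :=
  (CenteredNoise.sum fun i => CenteredNoise.of_coord fun s =>
    hrun.centeredNoise_coord h₁ h₂ hT k i s).map ((N : ℝ)⁻¹ • ContinuousLinearMap.id ℝ (Vec d))

theorem centeredNoise_coordVec (hrun : IsRun P T μ ℱ x q) (h₁ : P.WeightAssumption)
    (h₂ : P.SmoothAssumption) (hT : T.Admissible P) (k : ℕ) (s : Fin d) :
    CenteredNoise (ℱ k) μ fun ω => coordVec s fun i => q k ω i - x k ω i :=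
  CenteredNoise.of_coord fun i => hrun.centeredNoise_coord h₁ h₂ hT k i s

/-- Each iterate is bounded by a constant that may depend on `k`; this makes every expectation
below finite. -/
theorem memLp_x (hrun : IsRun P T μ ℱ x q) (h₁ : P.WeightAssumption)
    (h₂ : P.SmoothAssumption) (hT : T.Admissible P) (k : ℕ) :
    ∀ i, MemLp (fun ω => x k ω i) ⊤ μ := by
  induction k with
  | zero =>
    intro i
    simp_rw [hrun.init]
    exact memLp_const _
  | succ k ih =>
    intro i
    have hq : ∀ j, MemLp (fun ω => q k ω j) ⊤ μ := fun j => by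
      have := (ih j).add (CenteredNoise.of_coord (Z := fun ω => q k ω j - x k ω j) fun s =>
        hrun.centeredNoise_coord h₁ h₂ hT k j s).memLp
      refine this.congr_norm ((hrun.stronglyMeasurable_q k j).mono (ℱ.le _)).aestronglyMeasurable
        (ae_of_all _ fun ω => ?_)
      simp
    simp_rw [hrun.step_eq h₁]
    have hmix : MemLp (fun ω => ∑ j, P.A i j • q k ω j) ⊤ μ :=
      memLp_finsetSum _ fun j _ => (hq j).const_smul (P.A i j)
    have hg : MemLp (fun ω => gradient (P.f i) (x k ω i)) ⊤ μ :=
      (ih i).continuous_comp_top (h₂.continuous_gradient i)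
    exact ((ih i).add ((hmix.sub (ih i)).const_smul (T.stepsize P T.α k))).sub
      (hg.const_smul (T.stepsize P T.β k))

end IsRun

/-! ### Expected consensus error and expected descent -/

/-- With `c = ε (1 - ‖B‖)`, the left side is at most `((1 - c) ‖y‖ + c (η ‖h‖ / c))²`, and the bound
is convexity of the square. -/
theorem norm_contract_sub_sq_le {E : Type*} [NormedAddCommGroup E] [NormedSpace ℝ E]
    (B : E →L[ℝ] E) (hB : ‖B‖ < 1) {ε η : ℝ} (hε : 0 < ε) (hε1 : ε ≤ 1) (hη : 0 ≤ η) (y h : E) :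
    ‖y + ε • (B y - y) - η • h‖ ^ 2 ≤
      (1 - ε * (1 - ‖B‖)) * ‖y‖ ^ 2 + η ^ 2 * ‖h‖ ^ 2 / (ε * (1 - ‖B‖)) := by
  set c := ε * (1 - ‖B‖) with hc
  have hc0 : 0 < c := mul_pos hε (by linarith)
  have hc1 : c ≤ 1 := by nlinarith [norm_nonneg B]
  have h1 : ‖y + ε • (B y - y) - η • h‖ ≤ (1 - c) * ‖y‖ + η * ‖h‖ := by
    have e : y + ε • (B y - y) - η • h = (1 - ε) • y + ε • B y - η • h := by
      rw [smul_sub, sub_smul, one_smul]; abel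
    rw [e]
    refine (norm_sub_le _ _).trans (add_le_add ((norm_add_le _ _).trans ?_) ?_)
    · rw [norm_smul, norm_smul, Real.norm_of_nonneg hε.le,
        Real.norm_of_nonneg (by linarith : 0 ≤ 1 - ε)]
      have := mul_le_mul_of_nonneg_left (B.le_opNorm y) hε.le
      rw [hc]
      linarith
    · rw [norm_smul, Real.norm_of_nonneg hη]
  refine (pow_le_pow_left₀ (norm_nonneg _) h1 2).trans ?_
  rw [← sub_nonneg]
  have e : (1 - c) * ‖y‖ ^ 2 + η ^ 2 * ‖h‖ ^ 2 / c - ((1 - c) * ‖y‖ + η * ‖h‖) ^ 2 =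
      (1 - c) * (c * ‖y‖ - η * ‖h‖) ^ 2 / c := by
    field_simp
    ring
  rw [e]
  have : 0 ≤ 1 - c := by linarith
  positivity

theorem norm_coordVec_sq_le {N d : ℕ} (s : Fin d) {x : Fin N → Vec d} {R : ℝ}
    (h : ∀ i, |x i s| ≤ R) : ‖coordVec s x‖ ^ 2 ≤ N * R ^ 2 := by
  rw [EuclideanSpace.real_norm_sq_eq]
  calc ∑ i, (coordVec s x i) ^ 2 ≤ ∑ _i : Fin N, R ^ 2 :=
        Finset.sum_le_sum fun i _ => sq_le_sq' (abs_le.1 (h i)).1 (abs_le.1 (h i)).2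
    _ = _ := by simp

theorem norm_dev_sq_le {N d : ℕ} (hN : 0 < N) (s : Fin d) {x : Fin N → Vec d} {R : ℝ}
    (h : ∀ i, ‖x i‖ ≤ R) : ‖dev s x‖ ^ 2 ≤ N * (2 * R) ^ 2 := by
  refine norm_coordVec_sq_le s (x := fun i => x i - rowAvg x) fun i => ?_
  refine (PiLp.norm_apply_le (x i - rowAvg x) s).trans ?_
  linarith [norm_sub_le (x i) (rowAvg x), h i, norm_rowAvg_le hN h]

theorem continuous_dev {N d : ℕ} (s : Fin d) : Continuous (dev (N := N) s) := by
  unfold dev rowAvg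
  fun_prop

theorem continuous_rowAvg {N d : ℕ} : Continuous (rowAvg (N := N) (d := d)) := by
  unfold rowAvg
  fun_prop

theorem norm_rowAvg_sq_le_of_coord {N d : ℕ} {x : Fin N → Vec d} {R : ℝ}
    (h : ∀ i s, |x i s| ≤ R) : ‖rowAvg x‖ ^ 2 ≤ N * d * R ^ 2 := by
  refine (norm_rowAvg_sq_le x).trans ?_
  calc ∑ i, ‖x i‖ ^ 2 ≤ ∑ _i : Fin N, d * R ^ 2 := Finset.sum_le_sum fun i _ => by
        rw [EuclideanSpace.real_norm_sq_eq]
        calc ∑ s, (x i s) ^ 2 ≤ ∑ _s : Fin d, R ^ 2 := Finset.sum_le_sum fun s _ =>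
              sq_le_sq' (abs_le.1 (h i s)).1 (abs_le.1 (h i s)).2
          _ = _ := by simp
    _ = _ := by simp [mul_assoc]

theorem StepConditions.eventually_eps_le_one {ε η : ℕ → ℝ} (h : StepConditions ε η) :
    ∀ᶠ k in atTop, ε k ≤ 1 := by
  filter_upwards [h.eps_sq.tendsto_atTop_zero.eventually (gt_mem_nhds one_pos)] with k hk
  nlinarith [h.eps_pos k]

theorem StepConditions.tendsto_eta {ε η : ℕ → ℝ} (h : StepConditions ε η) :
    Tendsto η atTop (𝓝 0) := by
  have h1 := (Real.continuous_sqrt.tendsto 0).comp h.eta_sq.tendsto_atTop_zero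
  rw [Real.sqrt_zero] at h1
  exact h1.congr fun k => Real.sqrt_sq (h.eta_pos k).le

namespace IsRun

variable {N d : ℕ} {P : DistProblem N d} {T : Tuning} {Ω : Type*} {mΩ : MeasurableSpace Ω}
    {μ : Measure Ω} {ℱ : Filtration ℕ mΩ} {x q : ℕ → Ω → Fin N → Vec d}

theorem stronglyMeasurable_state (hrun : IsRun P T μ ℱ x q) (h₁ : P.WeightAssumption)
    (h₂ : P.SmoothAssumption) (k : ℕ) : StronglyMeasurable[ℱ k] (x k) :=
  ((@measurable_pi_iff _ _ _ (ℱ k) _ _).2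
    fun i => (hrun.stronglyMeasurable_x h₁ h₂ k i).measurable).stronglyMeasurable

/-- One step of descent. The averaged local gradient `g` differs from `∇F` by at most the consensus
error, and `-⟪∇F, g⟫ ≤ -‖∇F‖² / 2 + ‖∇F - g‖² / 2`. -/
theorem F_succ_le (hN : 0 < N) (hrun : IsRun P T μ ℱ x q)
    (h₁ : P.WeightAssumption) (h₂ : P.SmoothAssumption) (h₃ : P.BoundedGradAssumption)
    (hT : T.Admissible P) (k : ℕ) : ∀ᵐ ω ∂μ,
    P.F (rowAvg (x (k + 1) ω)) ≤ P.F (rowAvg (x k ω))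
      + ⟪T.stepsize P T.α k • gradient P.F (rowAvg (x k ω)),
          rowAvg fun i => q k ω i - x k ω i⟫
      - T.stepsize P T.β k / 2 * ‖gradient P.F (rowAvg (x k ω))‖ ^ 2
      + (T.stepsize P T.β k / 2 * P.gradLip ^ 2 * ∑ s, ‖dev s (x k ω)‖ ^ 2
        + P.gradLip * (2 * T.stepsize P T.α k ^ 2 * (N * d * T.ℓ ^ 2)
          + 2 * T.stepsize P T.β k ^ 2 * P.G ^ 2)) := by
  filter_upwards [hrun.abs_noise_le hT k] with ω hω
  have hε := Tuning.stepsize_pos hT T.α k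
  have hη := Tuning.stepsize_pos hT T.β k
  have hΛ := P.gradLip_nonneg
  have hξ := norm_rowAvg_sq_le_of_coord (x := fun i => q k ω i - x k ω i) hω
  have hg : ‖rowAvg fun i => gradient (P.f i) (x k ω i)‖ ≤ P.G :=
    norm_rowAvg_le hN fun i => h₃ i _
  have hdiff : ‖gradient P.F (rowAvg (x k ω)) - rowAvg fun i => gradient (P.f i) (x k ω i)‖ ^ 2
      ≤ P.gradLip ^ 2 * ∑ s, ‖dev s (x k ω)‖ ^ 2 := by
    rw [h₂.gradient_F, ← rowAvg_sub, ← sum_norm_dev_sq, Finset.mul_sum]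
    refine (norm_rowAvg_sq_le _).trans (Finset.sum_le_sum fun i _ => ?_)
    rw [← mul_pow, norm_sub_rev]
    exact pow_le_pow_left₀ (norm_nonneg _) (h₂.norm_sub_le i _ _) 2
  have hd := h₂.descent hN (rowAvg (x k ω))
    (T.stepsize P T.α k • rowAvg (fun i => q k ω i - x k ω i)
        - T.stepsize P T.β k • rowAvg fun i => gradient (P.f i) (x k ω i))
  rw [← hrun.rowAvg_succ h₁] at hd
  generalize T.stepsize P T.α k = ε at *
  generalize T.stepsize P T.β k = η at *
  generalize rowAvg (fun i => q k ω i - x k ω i) = ξ at *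
  generalize rowAvg (fun i => gradient (P.f i) (x k ω i)) = g at *
  generalize gradient P.F (rowAvg (x k ω)) = v at *
  rw [inner_sub_right, inner_smul_right, inner_smul_right] at hd
  rw [real_inner_smul_left]
  have hsq : ‖ε • ξ - η • g‖ ^ 2 ≤ 2 * ε ^ 2 * (N * d * T.ℓ ^ 2) + 2 * η ^ 2 * P.G ^ 2 := by
    have h4 := norm_sub_le (ε • ξ) (η • g)
    rw [norm_smul, norm_smul, Real.norm_of_nonneg hε.le, Real.norm_of_nonneg hη.le] at h4
    calc _ ≤ (ε * ‖ξ‖ + η * ‖g‖) ^ 2 := pow_le_pow_left₀ (norm_nonneg _) h4 2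
      _ ≤ 2 * ε ^ 2 * ‖ξ‖ ^ 2 + 2 * η ^ 2 * ‖g‖ ^ 2 := by
        nlinarith [sq_nonneg (ε * ‖ξ‖ - η * ‖g‖)]
      _ ≤ _ := by gcongr
  have h5 := mul_le_mul_of_nonneg_left hsq hΛ
  have h6 := norm_sub_sq_real v g
  have h7 := mul_le_mul_of_nonneg_left hdiff hη.le
  have h8 : 0 ≤ η * ‖g‖ ^ 2 := by positivity
  have h9 : η * ‖v - g‖ ^ 2 = η * ‖v‖ ^ 2 - 2 * (η * ⟪v, g⟫) + η * ‖g‖ ^ 2 := by rw [h6]; ring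
  linarith

variable [IsProbabilityMeasure μ]

theorem memLp_state (hrun : IsRun P T μ ℱ x q) (h₁ : P.WeightAssumption)
    (h₂ : P.SmoothAssumption) (hT : T.Admissible P) (k : ℕ) : MemLp (x k) ⊤ μ :=
  memLp_pi_iff.2 (hrun.memLp_x h₁ h₂ hT k)

/-- One step of consensus: contraction by `1 - ε (1 - ‖A - 1 1ᵀ / N‖)`, up to the gradient term and
the variance of the noise. The cross term with the noise vanishes in expectation. -/
theorem integral_norm_dev_succ_le (hN : 0 < N) (hrun : IsRun P T μ ℱ x q)
    (h₁ : P.WeightAssumption) (h₂ : P.SmoothAssumption) (h₃ : P.BoundedGradAssumption)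
    (hT : T.Admissible P) (s : Fin d) (k : ℕ) (hε1 : T.stepsize P T.α k ≤ 1) :
    ∫ ω, ‖dev s (x (k + 1) ω)‖ ^ 2 ∂μ ≤
      (1 - T.stepsize P T.α k * (1 - ‖P.gossip‖)) * ∫ ω, ‖dev s (x k ω)‖ ^ 2 ∂μ
        + (T.stepsize P T.β k ^ 2 * (N * (2 * P.G) ^ 2) / (T.stepsize P T.α k * (1 - ‖P.gossip‖))
          + T.stepsize P T.α k ^ 2 * (N * T.ℓ ^ 2)) := by
  have hB : ‖P.gossip‖ < 1 := h₁.norm_lt_one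
  have hε := Tuning.stepsize_pos hT T.α k
  have hη := Tuning.stepsize_pos hT T.β k
  set ε := T.stepsize P T.α k
  set η := T.stepsize P T.β k
  -- `U (x k)` is the part of the next deviation that is known before the quantization
  set U : (Fin N → Vec d) → EuclideanSpace ℝ (Fin N) := fun z =>
    dev s z + ε • (P.gossip (dev s z) - dev s z) - η • dev s (fun i => gradient (P.f i) (z i))
    with hU
  have hUc : Continuous U := by
    have h4 := continuous_dev (N := N) s
    have h5 : Continuous fun z : Fin N → Vec d => fun i => gradient (P.f i) (z i) :=
      continuous_pi fun i => (h₂.continuous_gradient i).comp (continuous_apply i)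
    exact (h4.add (((P.gossip.continuous.comp h4).sub h4).const_smul ε)).sub
      ((h4.comp h5).const_smul η)
  have hx := hrun.memLp_state h₁ h₂ hT k
  have hUm : StronglyMeasurable[ℱ k] fun ω => U (x k ω) :=
    hUc.comp_stronglyMeasurable (hrun.stronglyMeasurable_state h₁ h₂ k)
  have hUb : MemLp (fun ω => U (x k ω)) ⊤ μ := hx.continuous_comp_top hUc
  have hZ := (hrun.centeredNoise_coordVec h₁ h₂ hT k s).map (ε • P.gossip)
  have hD : Integrable (fun ω => ‖dev s (x k ω)‖ ^ 2) μ :=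
    (hx.continuous_comp_top (continuous_dev s)).norm_sq_top.integrable_top
  have e : ∀ ω, dev s (x (k + 1) ω) =
      U (x k ω) + (ε • P.gossip) (coordVec s fun i => q k ω i - x k ω i) := fun ω =>
    hrun.dev_succ hN h₁ s k ω
  simp_rw [e]
  rw [hZ.integral_norm_add_sq (ℱ.le k) hUm hUb, ← add_assoc]
  refine add_le_add ?_ ?_
  · calc ∫ ω, ‖U (x k ω)‖ ^ 2 ∂μ ≤ ∫ ω, ((1 - ε * (1 - ‖P.gossip‖)) * ‖dev s (x k ω)‖ ^ 2
          + η ^ 2 * (N * (2 * P.G) ^ 2) / (ε * (1 - ‖P.gossip‖))) ∂μ := by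
          refine integral_mono hUb.norm_sq_top.integrable_top
            ((hD.const_mul _).add (integrable_const _)) fun ω => ?_
          refine (norm_contract_sub_sq_le P.gossip hB hε hε1 hη.le _ _).trans ?_
          have h6 := norm_dev_sq_le hN s (x := fun i => gradient (P.f i) (x k ω i))
            (fun i => h₃ i _)
          have : 0 < 1 - ‖P.gossip‖ := by linarith
          gcongr
      _ = _ := by
          rw [integral_add (hD.const_mul _) (integrable_const _), integral_const_mul]
          simp
  · calc _ ≤ ∫ _ω, ε ^ 2 * (N * T.ℓ ^ 2) ∂μ := by
          refine integral_mono_ae hZ.memLp.norm_sq_top.integrable_top (integrable_const _) ?_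
          filter_upwards [hrun.abs_noise_le hT k] with ω hω
          have h7 := norm_coordVec_sq_le s (x := fun i => q k ω i - x k ω i) fun i => hω i s
          have h8 := P.gossip.le_of_opNorm_le hB.le (coordVec s fun i => q k ω i - x k ω i)
          rw [one_mul] at h8
          change ‖ε • P.gossip _‖ ^ 2 ≤ _
          rw [norm_smul, mul_pow, Real.norm_of_nonneg hε.le]
          gcongr
          exact (pow_le_pow_left₀ (norm_nonneg _) h8 2).trans h7
      _ = _ := by simp

/-- The consensus recursion, weighted by the antitone ratio `η / ε`, telescopes. -/
theorem summable_eta_mul_dev (hN : 0 < N) (hrun : IsRun P T μ ℱ x q)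
    (h₁ : P.WeightAssumption) (h₂ : P.SmoothAssumption) (h₃ : P.BoundedGradAssumption)
    (hT : T.Admissible P) (s : Fin d) :
    Summable fun k => T.stepsize P T.β k * ∫ ω, ‖dev s (x k ω)‖ ^ 2 ∂μ := by
  have hB : ‖P.gossip‖ < 1 := h₁.norm_lt_one
  have hB' : 0 < 1 - ‖P.gossip‖ := by linarith
  have hs := Tuning.stepConditions hT
  have hε := hs.eps_pos
  have hη := hs.eta_pos
  obtain ⟨K, hK⟩ := eventually_atTop.1 (hs.eventually_eps_le_one.and hs.ratio)
  have h := summable_weighted_of_contraction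
    (w := fun k => T.stepsize P T.β k / T.stepsize P T.α k)
    (e := fun k => T.stepsize P T.α k * (1 - ‖P.gossip‖))
    (v := fun k => ∫ ω, ‖dev s (x k ω)‖ ^ 2 ∂μ)
    (r := fun k => T.stepsize P T.β k ^ 2 * (N * (2 * P.G) ^ 2) /
        (T.stepsize P T.α k * (1 - ‖P.gossip‖)) + T.stepsize P T.α k ^ 2 * (N * T.ℓ ^ 2))
    K (fun n hn => (hK n hn).2) (fun n => (div_pos (hη n) (hε n)).le)
    (fun n => (mul_pos (hε n) hB').le) (fun n => integral_nonneg fun ω => sq_nonneg _)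
    (fun n => by have := hε n; positivity) ?_
    (fun n hn => hrun.integral_norm_dev_succ_le hN h₁ h₂ h₃ hT s n (hK n hn).1)
  · refine (h.mul_left (1 - ‖P.gossip‖)⁻¹).congr fun k => ?_
    have := hε k
    field_simp
  · refine ((hs.eta_cube.mul_left (N * (2 * P.G) ^ 2 / (1 - ‖P.gossip‖))).add
      (hs.eps_eta.mul_left (N * T.ℓ ^ 2))).congr fun k => ?_
    have := hε k
    field_simp

theorem summable_eta_mul_grad (hN : 0 < N) (hrun : IsRun P T μ ℱ x q)
    (h₁ : P.WeightAssumption) (h₂ : P.SmoothAssumption) (h₃ : P.BoundedGradAssumption)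
    (hT : T.Admissible P) :
    Summable fun k => T.stepsize P T.β k * ∫ ω, ‖gradient P.F (rowAvg (x k ω))‖ ^ 2 ∂μ := by
  have hs := Tuning.stepConditions hT
  have hε := hs.eps_pos
  have hη := hs.eta_pos
  have hΛ := P.gradLip_nonneg
  set b : ℕ → ℝ := fun k =>
    T.stepsize P T.β k / 2 * P.gradLip ^ 2 * ∑ s, ∫ ω, ‖dev s (x k ω)‖ ^ 2 ∂μ
        + P.gradLip * (2 * T.stepsize P T.α k ^ 2 * (N * d * T.ℓ ^ 2)
          + 2 * T.stepsize P T.β k ^ 2 * P.G ^ 2) with hb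
  have hb0 : ∀ k, 0 ≤ b k := fun k => by
    have h4 : 0 ≤ ∑ s, ∫ ω, ‖dev s (x k ω)‖ ^ 2 ∂μ :=
      Finset.sum_nonneg fun s _ => integral_nonneg fun ω => sq_nonneg _
    have := hη k
    simp only [hb]
    positivity
  have hbs : Summable b := by
    have h4 := (summable_sum fun s (_ : s ∈ Finset.univ) =>
      hrun.summable_eta_mul_dev hN h₁ h₂ h₃ hT s).mul_left (P.gradLip ^ 2 / 2)
    have h5 := hs.eps_sq.mul_left (P.gradLip * 2 * (N * d * T.ℓ ^ 2))
    have h6 := hs.eta_sq.mul_left (P.gradLip * 2 * P.G ^ 2)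
    refine (h4.add (h5.add h6)).congr fun k => ?_
    simp only [hb, ← Finset.mul_sum]
    ring
  have hxb : ∀ k, MemLp (fun ω => rowAvg (x k ω)) ⊤ μ := fun k =>
    (hrun.memLp_state h₁ h₂ hT k).continuous_comp_top continuous_rowAvg
  have hF : ∀ k, Integrable (fun ω => P.F (rowAvg (x k ω))) μ := fun k =>
    ((hxb k).continuous_comp_top h₂.continuous_F).integrable_top
  have hgb : ∀ k, MemLp (fun ω => gradient P.F (rowAvg (x k ω))) ⊤ μ := fun k =>
    (hxb k).continuous_comp_top h₂.continuous_gradient_F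
  have hg : ∀ k, Integrable (fun ω => ‖gradient P.F (rowAvg (x k ω))‖ ^ 2) μ := fun k =>
    (hgb k).norm_sq_top.integrable_top
  have hD : ∀ k s, Integrable (fun ω => ‖dev s (x k ω)‖ ^ 2) μ := fun k s =>
    ((hrun.memLp_state h₁ h₂ hT k).continuous_comp_top
      (continuous_dev s)).norm_sq_top.integrable_top
  have h := summable_of_le_sub_add (u := fun k => ∫ ω, P.F (rowAvg (x k ω)) ∂μ)
    (a := fun k => T.stepsize P T.β k / 2 * ∫ ω, ‖gradient P.F (rowAvg (x k ω))‖ ^ 2 ∂μ)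
    (b := b) (m := T.fstar) 0 (fun k => ?_) (fun k => ?_) hb0 hbs (fun k _ => ?_)
  · refine (h.mul_left 2).congr fun k => by ring
  · calc T.fstar = ∫ _ω, T.fstar ∂μ := by simp
      _ ≤ _ := integral_mono (integrable_const _) (hF k) fun ω => hT.fstar_le _
  · exact mul_nonneg (by linarith [hη k]) (integral_nonneg fun ω => sq_nonneg _)
  · have hZ := hrun.centeredNoise_rowAvg h₁ h₂ hT k
    have hUb := (hgb k).const_smul (T.stepsize P T.α k)
    have hUm : StronglyMeasurable[ℱ k]
        fun ω => T.stepsize P T.α k • gradient P.F (rowAvg (x k ω)) :=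
      (((h₂.continuous_gradient_F.comp continuous_rowAvg).const_smul
        (T.stepsize P T.α k)).comp_stronglyMeasurable (hrun.stronglyMeasurable_state h₁ h₂ k))
    have h0 := hZ.integral_inner_eq_zero (ℱ.le k) hUm hUb
    have hi := (hUb.inner_top hZ.memLp).integrable_top
    simp only [Pi.smul_apply] at hi
    have hgk := (hg k).const_mul (T.stepsize P T.β k / 2)
    have hDk : Integrable (fun ω => T.stepsize P T.β k / 2 * P.gradLip ^ 2 *
        ∑ s, ‖dev s (x k ω)‖ ^ 2) μ := (integrable_finsetSum _ fun s _ => hD k s).const_mul _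
    have hc : Integrable (fun _ : Ω => P.gradLip *
        (2 * T.stepsize P T.α k ^ 2 * (N * d * T.ℓ ^ 2)
          + 2 * T.stepsize P T.β k ^ 2 * P.G ^ 2)) μ := integrable_const _
    refine (integral_mono_ae (hF (k + 1)) ((((hF k).add hi).sub hgk).add (hDk.add hc))
      (hrun.F_succ_le hN h₁ h₂ h₃ hT k)).trans_eq ?_
    rw [integral_add' (((hF k).add hi).sub hgk) (hDk.add hc), integral_sub' ((hF k).add hi) hgk,
      integral_add' (hF k) hi, integral_add' hDk hc, h0, integral_const_mul, integral_const_mul,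
      integral_finsetSum _ fun s _ => hD k s]
    simp [hb]

end IsRun

/-! ### Almost sure convergence -/

namespace IsRun

variable {N d : ℕ} {P : DistProblem N d} {T : Tuning} {Ω : Type*} {mΩ : MeasurableSpace Ω}
    {μ : Measure Ω} {ℱ : Filtration ℕ mΩ} {x q : ℕ → Ω → Fin N → Vec d}

theorem rowAvg_sub_eq (hrun : IsRun P T μ ℱ x q) (h₁ : P.WeightAssumption) (ω : Ω) {m n : ℕ}
    (hmn : m ≤ n) :
    rowAvg (x n ω) - rowAvg (x m ω) =
      (∑ k ∈ Finset.range n, T.stepsize P T.α k • rowAvg (fun i => q k ω i - x k ω i)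
        - ∑ k ∈ Finset.range m, T.stepsize P T.α k • rowAvg (fun i => q k ω i - x k ω i))
      - ∑ k ∈ Finset.Ico m n, T.stepsize P T.β k • rowAvg fun i => gradient (P.f i) (x k ω i) := by
  rw [← Finset.sum_Ico_eq_sub _ hmn, ← Finset.sum_sub_distrib,
    ← Finset.sum_Ico_sub (fun k => rowAvg (x k ω)) hmn]
  refine Finset.sum_congr rfl fun k _ => ?_
  rw [hrun.rowAvg_succ h₁, add_sub_cancel_left]

theorem norm_gradient_le (hN : 0 < N) (hrun : IsRun P T μ ℱ x q) (h₁ : P.WeightAssumption)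
    (h₂ : P.SmoothAssumption) (h₃ : P.BoundedGradAssumption) (hT : T.Admissible P) (ω : Ω) {m n : ℕ}
    (hmn : m ≤ n) :
    ‖gradient P.F (rowAvg (x n ω))‖ ≤ ‖gradient P.F (rowAvg (x m ω))‖
      + P.gradLip *
        ‖∑ k ∈ Finset.range n, T.stepsize P T.α k • rowAvg (fun i => q k ω i - x k ω i)
        - ∑ k ∈ Finset.range m, T.stepsize P T.α k • rowAvg (fun i => q k ω i - x k ω i)‖
      + P.gradLip * P.G * ∑ k ∈ Finset.Ico m n, T.stepsize P T.β k := by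
  have h4 := h₂.norm_gradient_F_sub_le hN (rowAvg (x n ω)) (rowAvg (x m ω))
  have h5 := norm_sub_norm_le (gradient P.F (rowAvg (x n ω))) (gradient P.F (rowAvg (x m ω)))
  rw [hrun.rowAvg_sub_eq h₁ ω hmn] at h4
  have h6 : ‖∑ k ∈ Finset.Ico m n, T.stepsize P T.β k •
      rowAvg fun i => gradient (P.f i) (x k ω i)‖ ≤
        P.G * ∑ k ∈ Finset.Ico m n, T.stepsize P T.β k := by
    rw [Finset.mul_sum]
    refine norm_sum_le_of_le _ fun k _ => ?_
    have h7 := Tuning.stepsize_pos hT T.β k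
    rw [norm_smul, Real.norm_of_nonneg h7.le, mul_comm]
    exact mul_le_mul_of_nonneg_right (norm_rowAvg_le hN fun i => h₃ i _) h7.le
  have h8 := h4.trans (mul_le_mul_of_nonneg_left ((norm_sub_le _ _).trans (add_le_add_right h6 _))
    P.gradLip_nonneg)
  linarith

variable [IsProbabilityMeasure μ]

theorem ae_cauchySeq_noise (hrun : IsRun P T μ ℱ x q) (h₁ : P.WeightAssumption)
    (h₂ : P.SmoothAssumption) (hT : T.Admissible P) : ∀ᵐ ω ∂μ, CauchySeq fun n =>
      ∑ k ∈ Finset.range n, T.stepsize P T.α k • rowAvg (fun i => q k ω i - x k ω i) := by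
  have key : ∀ s : Fin d, ∀ᵐ ω ∂μ, ∃ c, Tendsto (fun n => ∑ k ∈ Finset.range n,
      T.stepsize P T.α k * rowAvg (fun i => q k ω i - x k ω i) s) atTop (𝓝 c) := by
    intro s
    refine ae_exists_tendsto_sum_noise (ℱ := ℱ) (R := √(N * d * T.ℓ ^ 2)) (fun k => ?_)
      (fun k => (hrun.centeredNoise_rowAvg h₁ h₂ hT k).map (EuclideanSpace.proj s)) (fun k => ?_)
      (Tuning.stepConditions hT).eps_sq
    · have h4 : StronglyMeasurable[ℱ (k + 1)] fun ω => ∑ i, (q k ω i - x k ω i) :=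
        Finset.stronglyMeasurable_fun_sum _ fun i _ => (hrun.stronglyMeasurable_q k i).sub
          ((hrun.stronglyMeasurable_x h₁ h₂ k i).mono (ℱ.mono (Nat.le_succ k)))
      exact (EuclideanSpace.proj (𝕜 := ℝ) s).continuous.comp_stronglyMeasurable
        (h4.const_smul (N : ℝ)⁻¹)
    · filter_upwards [hrun.abs_noise_le hT k] with ω hω
      exact (PiLp.norm_apply_le (rowAvg fun i => q k ω i - x k ω i) s).trans
        (Real.le_sqrt_of_sq_le (norm_rowAvg_sq_le_of_coord hω))
  filter_upwards [ae_all_iff.2 key] with ω hω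
  choose c hc using hω
  have h4 : Tendsto (fun n => ∑ k ∈ Finset.range n,
      T.stepsize P T.α k • rowAvg (fun i => q k ω i - x k ω i)) atTop (𝓝 (WithLp.toLp 2 c)) := by
    have h5 := ((PiLp.continuous_toLp 2 fun _ : Fin d => ℝ).tendsto c).comp
      (tendsto_pi_nhds.2 hc)
    refine h5.congr fun n => ?_
    ext s
    simp
  exact h4.cauchySeq

theorem ae_tendsto_norm_gradient (hN : 0 < N) (hrun : IsRun P T μ ℱ x q)
    (h₁ : P.WeightAssumption) (h₂ : P.SmoothAssumption) (h₃ : P.BoundedGradAssumption)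
    (hT : T.Admissible P) :
    ∀ᵐ ω ∂μ, Tendsto (fun k => ‖gradient P.F (rowAvg (x k ω))‖) atTop (𝓝 0) := by
  have hs := Tuning.stepConditions hT
  have hgi : ∀ k, Integrable (fun ω => T.stepsize P T.β k *
      ‖gradient P.F (rowAvg (x k ω))‖ ^ 2) μ := fun k =>
    ((hrun.memLp_state h₁ h₂ hT k).continuous_comp_top
      (h₂.continuous_gradient_F.comp continuous_rowAvg)).norm_sq_top.integrable_top.const_mul _
  have hsum := hrun.summable_eta_mul_grad hN h₁ h₂ h₃ hT
  simp_rw [← integral_const_mul] at hsum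
  have hG : 0 ≤ P.G := (norm_nonneg _).trans (h₃ ⟨0, hN⟩ 0)
  filter_upwards [ae_summable_of_summable_integral hgi
    (fun k ω => mul_nonneg (hs.eta_pos k).le (sq_nonneg _)) hsum,
    hrun.ae_cauchySeq_noise h₁ h₂ hT] with ω h4 h5
  exact tendsto_zero_of_summable_mul_sq P.gradLip_nonneg (mul_nonneg P.gradLip_nonneg hG)
    (fun _ => norm_nonneg _) (fun k => (hs.eta_pos k).le) hs.tendsto_eta hs.eta_div h4 h5
    fun m n hmn => hrun.norm_gradient_le hN h₁ h₂ h₃ hT ω hmn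

end IsRun

end

theorem mainTheorem4 {N d : ℕ} (hN : 0 < N) (P : DistProblem N d) (T : Tuning)
    (h₁ : P.WeightAssumption) (h₂ : P.SmoothAssumption) (h₃ : P.BoundedGradAssumption)
    (hρ : 0 < P.rhoAvg) (hT : T.Admissible P)
    {Ω : Type*} {mΩ : MeasurableSpace Ω} (μ : Measure Ω) [IsProbabilityMeasure μ]
    (ℱ : Filtration ℕ mΩ) (x q : ℕ → Ω → Fin N → Vec d) (hrun : IsRun P T μ ℱ x q) :
    ENNReal.ofReal (1 - T.p) ≤
      μ {ω | Tendsto (fun k => ‖gradient P.F (rowAvg (x k ω))‖ ^ 2) atTop (𝓝 0)} := by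
  have h : ∀ᵐ ω ∂μ, Tendsto (fun k => ‖gradient P.F (rowAvg (x k ω))‖ ^ 2) atTop (𝓝 0) := by
    filter_upwards [hrun.ae_tendsto_norm_gradient hN h₁ h₂ h₃ hT] with ω hω
    simpa using hω.pow 2
  have hone : μ {ω | Tendsto (fun k => ‖gradient P.F (rowAvg (x k ω))‖ ^ 2) atTop (𝓝 0)} = 1 := by
    rw [measure_congr (eventuallyEq_univ.2 h), measure_univ]
  rw [hone]
  exact ENNReal.ofReal_le_one.2 (by linarith [hT.p_pos])
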